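/- Let $q_\delta:\mathbb{R}\to\delta\mathbb{Z}$ be the uniform scalar quantizer with stepsize $\delta>0$, i.e. $q_\delta(t)=n\delta$ for $t\in(n\delta-\delta/2,\,n\delta+\delta/2]$, $n\in\mathbb{Z}$, and let $Q$ apply $q_\delta$ to every entry of a vector. For $E\in\mathbb{R}^{m\times k}$ of full column rank let $E^\dagger=(E^TE)^{-1}E^T$, and for $x\in\mathbb{R}^k$ let $\mathcal{E}(x)=\|x-E^\dagger Q(Ex)\|$, where $\|\cdot\|$ is the Euclidean norm. Put $\lambda=m/k$, $A=(1/2-\lambda^{-1/2})^{-2}$ and $A'=(3/2+\lambda^{-1/2})^{-2}$. There is an absolute constant $C>0$ such that the following holds. Let $k\ge 3$, $x\in\mathbb{R}^k$, $\delta>0$ and $c_2\in(0,1)$, and set $c_1=C\sqrt{\ln(e^2c_2^{-1})}$. Let $m\in\mathbb{N}$ be such that $\lambda>4$, and let $E$ be a random $m\times k$ matrix with i.i.d. standard Gaussian entries. Then, with probability at least $1-2e^{-m/8}-c_2$, the matrix $E$ has full column rank and both $$\mathcal{E}(x)<A\left(2\|x\|e^{-2\pi^2\|x\|^2/\delta^2}+c_1\sqrt{\ln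 k}\,\lambda^{-1/2}\delta\right)$$ and $$\mathcal{E}(x)>A'\left(2\|x\|e^{-2\pi^2\|x\|^2/\delta^2}-2\|x\|e^{-8\pi^2\|x\|^2/\delta^2}-c_1\sqrt{\ln k}\,\lambda^{-1/2}\delta\right)$$ hold. In particular, the error does not vanish as the redundancy $\lambda$ grows: for all $k\ge3$, $x\in\mathbb{R}^k\setminus\{0\}$ and $\delta>0$ there is $\varepsilon>0$ such that, for $m\times k$ matrices $E$ with i.i.d. standard Gaussian entries, the probability that $E$ has full column rank and $\mathcal{E}(x)>\varepsilon$ tends to $1$ as $m\to\infty$. -/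

import Mathlib

open MeasureTheory ProbabilityTheory

open scoped Matrix

noncomputable section

/-- The uniform scalar quantizer `q_δ : ℝ → δℤ` with stepsize `δ > 0`: it maps `t` to `n δ`, where
`n` is the integer with `t ∈ (n δ - δ / 2, n δ + δ / 2]` (see `scalarQuantizer_eq_iff`). -/
def scalarQuantizer (δ t : ℝ) : ℝ :=
  (⌈t / δ - 1 / 2⌉ : ℝ) * δ

theorem scalarQuantizer_eq_iff {δ : ℝ} (hδ : 0 < δ) (t : ℝ) (n : ℤ) :
    scalarQuantizer δ t = n * δ ↔ t ∈ Set.Ioc (n * δ - δ / 2) (n * δ + δ / 2) := by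
  have h1 : scalarQuantizer δ t = n * δ ↔ ⌈t / δ - 1 / 2⌉ = n := by
    unfold scalarQuantizer
    rw [mul_left_inj' hδ.ne']
    exact Int.cast_inj
  have ht : t = t / δ * δ := (div_mul_cancel₀ t hδ.ne').symm
  rw [h1, Int.ceil_eq_iff, Set.mem_Ioc]
  constructor
  · rintro ⟨ha, hb⟩
    constructor <;> rw [ht] <;> nlinarith
  · rintro ⟨ha, hb⟩
    rw [ht] at ha hb
    constructor
    · by_contra hc
      push Not at hc
      nlinarith
    · by_contra hc
      push Not at hc
      nlinarith

/-- Memoryless scalar quantization with stepsize `δ`: the scalar quantizer acts on each entry. -/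
def msq (δ : ℝ) {m : ℕ} (u : Fin m → ℝ) : Fin m → ℝ :=
  fun j => scalarQuantizer δ (u j)

/-- The Moore-Penrose pseudoinverse `(Eᵀ E)⁻¹ Eᵀ` of a real matrix `E` of full column rank. -/
def pinv {m k : ℕ} (E : Matrix (Fin m) (Fin k) ℝ) : Matrix (Fin k) (Fin m) ℝ :=
  (Eᵀ * E)⁻¹ * Eᵀ

/-- The reconstruction error `‖x - E† Q(E x)‖` in the Euclidean norm, where `Q` is memoryless
scalar quantization with stepsize `δ`. -/
def reconstructionError {m k : ℕ} (δ : ℝ) (E : Matrix (Fin m) (Fin k) ℝ)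
    (x : EuclideanSpace ℝ (Fin k)) : ℝ :=
  ‖x - WithLp.toLp 2 (pinv E *ᵥ msq δ (E *ᵥ x.ofLp))‖

/-- A random matrix whose entries are independent standard Gaussian random variables. -/
structure IsGaussianMatrix {Ω : Type*} [MeasurableSpace Ω] {m k : ℕ}
    (E : Ω → Matrix (Fin m) (Fin k) ℝ) (P : Measure Ω) : Prop where
  hasLaw : ∀ i j, HasLaw (fun ω => E ω i j) (gaussianReal 0 1) P
  iIndepFun : iIndepFun (fun (p : Fin m × Fin k) ω => E ω p.1 p.2) P

end

/-!
Let `r = Ex - Q(Ex)` be the vector of quantization residuals. The error vector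
`e = x - E† Q(Ex)` solves the normal equations `Eᵀ E e = Eᵀ r`. Hence, if all singular values of
`E` lie in `[s, S]` with `0 < s`, then `S⁻² ‖Eᵀ r‖ ≤ ‖e‖ ≤ s⁻² ‖Eᵀ r‖`, and also
`‖e‖ ≤ s⁻¹ ‖r‖ ≤ s⁻¹ √m δ / 2`.

*The mean of `Eᵀ r / m`.* For a standard Gaussian vector `g` and the scalar residual
`r(t) = t - q_δ(t)`, the mean of `g r(⟨g, x⟩)` is `D x` with
`D = 2 ∑ (-1)ⁿ exp (-a (n + 1)²)`, `a = 2 π² ‖x‖² / δ²`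
(`exists_integral_mul_quantResidual_eq`); the main terms of the two bounds are the first two partial
sums of this alternating series. The Fourier series of `r` converges only conditionally, so the
formula is derived from `r² / 2` instead, which is Lipschitz and has an absolutely convergent cosine
series: the mean of `r(⟨g, x⟩)² / 2` is differentiated with respect to a coordinate of `x`, once
under the integral sign and once term by term in its series (`integral_mul_quantResidual`).

*Concentration.* The summands of a coordinate of `Eᵀ r` are dominated by `δ / 2` times a standard
Gaussian, so they are sub-Gaussian after centring (`hasSubgaussianMGF_sub_integral_of_abs_le`), and
a union bound over the `k` coordinates gives `‖Eᵀ r / m - D x‖ < c₁ √(ln k) λ^(-1/2) δ` with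
probability at least `1 - c₂`.

*Singular values.* The sharp Gaussian constants in `A` and `A'` are not needed, because `C` is
free. If `λ ≥ 200`, a net argument with chi-square tails puts all singular values between `√m / 2`
and `3 √m / 2`, off an event of probability at most `2 exp (-m / 8)`; this suffices as `4 ≤ A` and
`A' ≤ 4 / 9`. If `4 < λ < 200`, the same net argument gives singular values at least `√m / 20`
with the same probability. Then `‖e‖ ≤ 10 δ`, whereas for a large constant `C` the term
`c₁ √(ln k) λ^(-1/2) δ` is at least `20 δ`, so that the upper bound holds trivially, and the lower
bound holds because its left-hand side is negative.

The non-vanishing of the error follows by letting `m` tend to infinity in the lower bound.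
-/

/-! ### The quantization residual -/

/-- The residual `t - q_δ(t)` of the uniform scalar quantizer. -/
noncomputable def quantResidual (δ t : ℝ) : ℝ := t - scalarQuantizer δ t

theorem exists_scalarQuantizer_eq (δ t : ℝ) : ∃ n : ℤ, scalarQuantizer δ t = n * δ := ⟨_, rfl⟩

theorem quantResidual_mem {δ : ℝ} (hδ : 0 < δ) (t : ℝ) :
    quantResidual δ t ∈ Set.Ioc (-(δ / 2)) (δ / 2) := by
  obtain ⟨n, hn⟩ := exists_scalarQuantizer_eq δ t
  have h := (scalarQuantizer_eq_iff hδ t n).1 hn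
  rw [quantResidual, hn]
  constructor <;> linarith [h.1, h.2]

theorem abs_quantResidual_le {δ : ℝ} (hδ : 0 < δ) (t : ℝ) : |quantResidual δ t| ≤ δ / 2 := by
  have h := quantResidual_mem hδ t
  exact abs_le.2 ⟨h.1.le, h.2⟩

theorem measurable_quantResidual (δ : ℝ) : Measurable (quantResidual δ) := by
  unfold quantResidual scalarQuantizer
  fun_prop

/-- The quantizer picks the nearest point of `δℤ`. -/
theorem quantResidual_sq_le {δ : ℝ} (hδ : 0 < δ) (t : ℝ) (n : ℤ) :
    quantResidual δ t ^ 2 ≤ (t - n * δ) ^ 2 := by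
  obtain ⟨p, hp⟩ := exists_scalarQuantizer_eq δ t
  have h := (scalarQuantizer_eq_iff hδ t p).1 hp
  rw [quantResidual, hp]
  rcases lt_trichotomy p n with hpn | rfl | hpn
  · have : (p : ℝ) + 1 ≤ n := by exact_mod_cast hpn
    have h1 := h.2
    nlinarith [mul_le_mul_of_nonneg_right this hδ.le]
  · rfl
  · have : (n : ℝ) + 1 ≤ p := by exact_mod_cast hpn
    have h1 := h.1
    nlinarith [mul_le_mul_of_nonneg_right this hδ.le]

theorem quantResidual_sq_sub_le {δ : ℝ} (hδ : 0 < δ) (s t : ℝ) :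
    quantResidual δ t ^ 2 - quantResidual δ s ^ 2 ≤ 2 * δ * |t - s| := by
  have hs := abs_quantResidual_le hδ s
  have ht := abs_quantResidual_le hδ t
  rcases le_total δ |t - s| with h | h
  · have : quantResidual δ t ^ 2 ≤ (δ / 2) ^ 2 := sq_le_sq' (abs_le.1 ht).1 (abs_le.1 ht).2
    nlinarith [sq_nonneg (quantResidual δ s)]
  · obtain ⟨p, hp⟩ := exists_scalarQuantizer_eq δ s
    have h1 := quantResidual_sq_le hδ t p
    have h2 : t - p * δ = quantResidual δ s + (t - s) := by rw [quantResidual, hp]; ring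
    have h3 : quantResidual δ s * (t - s) ≤ δ / 2 * |t - s| :=
      (le_abs_self _).trans (by rw [abs_mul]; gcongr)
    have h4 : (t - s) ^ 2 ≤ δ * |t - s| := by
      rw [← sq_abs, sq]; gcongr
    rw [h2] at h1
    nlinarith

/-- Half the squared residual is Lipschitz, although the residual itself jumps. -/
theorem abs_half_quantResidual_sq_sub_le {δ : ℝ} (hδ : 0 < δ) (s t : ℝ) :
    |quantResidual δ t ^ 2 / 2 - quantResidual δ s ^ 2 / 2| ≤ δ * |t - s| := by
  have h1 := quantResidual_sq_sub_le hδ s t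
  have h2 := quantResidual_sq_sub_le hδ t s
  rw [abs_sub_comm s t] at h2
  exact abs_le.2 ⟨by linarith, by linarith⟩

theorem hasDerivAt_half_quantResidual_sq {δ : ℝ} (hδ : 0 < δ) {t : ℝ}
    (ht : t ∉ Set.range fun n : ℤ => n * δ + δ / 2) :
    HasDerivAt (fun y => quantResidual δ y ^ 2 / 2) (quantResidual δ t) t := by
  obtain ⟨p, hp⟩ := exists_scalarQuantizer_eq δ t
  have h := (scalarQuantizer_eq_iff hδ t p).1 hp
  have h2 : t < p * δ + δ / 2 := lt_of_le_of_ne h.2 fun he => ht ⟨p, he.symm⟩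
  have hev : (fun y => quantResidual δ y ^ 2 / 2) =ᶠ[nhds t] fun y => (y - p * δ) ^ 2 / 2 := by
    filter_upwards [Ioo_mem_nhds h.1 h2] with y hy
    rw [quantResidual, (scalarQuantizer_eq_iff hδ y p).2 ⟨hy.1, hy.2.le⟩]
  have hd : HasDerivAt (fun y => (y - p * δ) ^ 2 / 2) (quantResidual δ t) t := by
    have := (((hasDerivAt_id t).sub_const (p * δ)).pow 2).div_const 2
    refine this.congr_deriv ?_
    rw [quantResidual, hp]
    simp
  exact hd.congr_of_eventuallyEq hev

/-- The Fourier series of half the squared residual. It is the series of the second Bernoulli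
polynomial, and, unlike the series of the residual itself, it converges absolutely. -/
theorem hasSum_half_quantResidual_sq {δ : ℝ} (hδ : 0 < δ) (t : ℝ) :
    HasSum (fun n : ℕ => δ ^ 2 / (2 * Real.pi ^ 2) * ((-1) ^ n / (n : ℝ) ^ 2) *
      Real.cos (2 * Real.pi * n / δ * t))
      (quantResidual δ t ^ 2 / 2 - δ ^ 2 / 24) := by
  obtain ⟨p, hp⟩ := exists_scalarQuantizer_eq δ t
  have h := quantResidual_mem hδ t
  -- The second Bernoulli polynomial is symmetric about `1 / 2`, which corresponds to residual `0`.
  have hz : quantResidual δ t / δ + 1 / 2 ∈ Set.Icc (0 : ℝ) 1 := by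
    have h1 : -(1 / 2) < quantResidual δ t / δ := by
      rw [lt_div_iff₀ hδ]; linarith [h.1]
    have h2 : quantResidual δ t / δ ≤ 1 / 2 := by
      rw [div_le_iff₀ hδ]; linarith [h.2]
    constructor <;> linarith
  have hs := (hasSum_one_div_nat_pow_mul_cos one_ne_zero hz).mul_left (δ ^ 2 / (2 * Real.pi ^ 2))
  have hb : (Polynomial.map (algebraMap ℚ ℝ) (Polynomial.bernoulli (2 * 1))).eval
      (quantResidual δ t / δ + 1 / 2) = (quantResidual δ t / δ) ^ 2 - 1 / 12 := by
    rw [Polynomial.eval_map_algebraMap]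
    simp [Polynomial.bernoulli, Finset.sum_range_succ, bernoulli_two]
    ring
  rw [hb] at hs
  convert! hs using 1
  · ext n
    have : 2 * Real.pi * n * (quantResidual δ t / δ + 1 / 2) =
        2 * Real.pi * n / δ * t + n * Real.pi - ((n * p : ℤ) : ℝ) * (2 * Real.pi) := by
      rw [quantResidual, hp]
      push_cast
      field_simp
      ring
    rw [this, Real.cos_sub_int_mul_two_pi, Real.cos_add_nat_mul_pi]
    ring
  · have := Real.pi_pos.ne'
    simp
    field_simp
    ring

theorem tsum_alternating_exp_sq_bounds {a : ℝ} (ha : 0 < a) :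
    Real.exp (-a) - Real.exp (-(4 * a)) ≤
      ∑' n : ℕ, (-1 : ℝ) ^ n * Real.exp (-(a * ((n : ℝ) + 1) ^ 2)) ∧
    ∑' n : ℕ, (-1 : ℝ) ^ n * Real.exp (-(a * ((n : ℝ) + 1) ^ 2)) ≤ Real.exp (-a) := by
  have hanti : Antitone fun n : ℕ => Real.exp (-(a * ((n : ℝ) + 1) ^ 2)) := by
    intro n p hnp
    have : (n : ℝ) ≤ p := by exact_mod_cast hnp
    dsimp only
    gcongr
  have hsum : Summable fun n : ℕ => Real.exp (-(a * ((n : ℝ) + 1) ^ 2)) := by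
    refine Summable.of_nonneg_of_le (fun n => (Real.exp_pos _).le) (fun n => ?_)
      (summable_geometric_of_lt_one (Real.exp_pos (-a)).le (by simpa using ha))
    rw [← Real.exp_nat_mul]
    gcongr
    nlinarith [mul_nonneg ha.le (sq_nonneg (n : ℝ)),
      mul_nonneg ha.le (Nat.cast_nonneg (α := ℝ) n)]
  have ht := hsum.tendsto_alternating_series_tsum
  constructor
  · refine le_trans (le_of_eq ?_) (hanti.alternating_series_le_tendsto ht 1)
    simp [Finset.sum_range_succ]
    norm_num
    ring_nf
  · refine (hanti.tendsto_le_alternating_series ht 0).trans (le_of_eq ?_)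
    simp

/-! ### Linear functionals of a standard Gaussian vector -/

/-- The law of a vector with independent standard Gaussian coordinates. -/
noncomputable def stdGaussianPi (ι : Type*) [Fintype ι] : Measure (ι → ℝ) :=
  Measure.pi fun _ => gaussianReal 0 1

instance (ι : Type*) [Fintype ι] : IsProbabilityMeasure (stdGaussianPi ι) := by
  unfold stdGaussianPi; infer_instance

theorem hasLaw_eval_stdGaussianPi {ι : Type*} [Fintype ι] (i : ι) :
    HasLaw (fun g : ι → ℝ => g i) (gaussianReal 0 1) (stdGaussianPi ι) :=
  ⟨(measurable_pi_apply i).aemeasurable, (measurePreserving_eval _ i).map_eq⟩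

theorem integrable_eval_stdGaussianPi {ι : Type*} [Fintype ι] (i : ι) :
    Integrable (fun g : ι → ℝ => g i) (stdGaussianPi ι) := by
  have h : Integrable id (gaussianReal 0 1) := (memLp_id_gaussianReal 1).integrable (by simp)
  rw [← (hasLaw_eval_stdGaussianPi i).map_eq] at h
  exact h.comp_measurable (measurable_pi_apply i)

theorem measurable_dotProduct_const {ι : Type*} [Fintype ι] (x : ι → ℝ) :
    Measurable fun g : ι → ℝ => g ⬝ᵥ x := by
  unfold dotProduct
  fun_prop

theorem hasLaw_dotProduct_stdGaussianPi {ι : Type*} [Fintype ι] (x : ι → ℝ) :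
    HasLaw (fun g => g ⬝ᵥ x) (gaussianReal 0 (x ⬝ᵥ x).toNNReal) (stdGaussianPi ι) := by
  refine ⟨(measurable_dotProduct_const x).aemeasurable, ?_⟩
  have hind : iIndepFun (fun (i : ι) (g : ι → ℝ) => g i * x i) (stdGaussianPi ι) :=
    iIndepFun_pi (X := fun i y => y * x i) fun i => by fun_prop
  have : IsProbabilityMeasure ((stdGaussianPi ι).map fun g => g ⬝ᵥ x) :=
    Measure.isProbabilityMeasure_map (measurable_dotProduct_const x).aemeasurable
  refine Measure.ext_of_charFun ?_
  have h := hind.charFun_map_fun_sum_eq_prod fun i =>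
    ((measurable_pi_apply i).mul_const (x i)).aemeasurable
  refine h.trans ?_
  ext t
  have hx : 0 ≤ x ⬝ᵥ x := Finset.sum_nonneg fun i _ => mul_self_nonneg _
  have hi : ∀ i, charFun ((stdGaussianPi ι).map fun g => g i * x i) t =
      Complex.exp (-(x i * x i * t ^ 2 / 2 : ℝ)) := by
    intro i
    rw [(gaussianReal_mul_const (hasLaw_eval_stdGaussianPi i) (x i)).map_eq, charFun_gaussianReal]
    congr 1
    simp
    ring_nf
    simp
  rw [Finset.prod_apply, Finset.prod_congr rfl fun i _ => hi i, ← Complex.exp_sum,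
    charFun_gaussianReal]
  congr 1
  rw [Real.coe_toNNReal _ hx]
  simp [dotProduct, Finset.sum_div, Finset.sum_mul]

theorem integral_cos_gaussianReal (v : NNReal) (c : ℝ) :
    ∫ t, Real.cos (c * t) ∂(gaussianReal 0 v) = Real.exp (-(c ^ 2 * v / 2)) := by
  have h := charFun_gaussianReal (μ := 0) (v := v) c
  rw [charFun_apply_real] at h
  have hre := congrArg Complex.re h
  have hint : Integrable (fun t : ℝ => Complex.exp (c * t * Complex.I)) (gaussianReal 0 v) := by
    refine Integrable.of_bound (C := 1) (by fun_prop) (.of_forall fun t => ?_)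
    rw [← Complex.ofReal_mul, Complex.norm_exp_ofReal_mul_I]
  have h2 : (∫ t : ℝ, Complex.exp (c * t * Complex.I) ∂(gaussianReal 0 v)).re =
      ∫ t : ℝ, (Complex.exp (c * t * Complex.I)).re ∂(gaussianReal 0 v) :=
    (integral_re hint).symm
  rw [h2] at hre
  have h3 : ∀ t : ℝ, (Complex.exp (c * t * Complex.I)).re = Real.cos (c * t) := fun t => by
    rw [← Complex.ofReal_mul, Complex.exp_ofReal_mul_I_re]
  simp_rw [h3] at hre
  rw [hre, show (c * (0 : ℝ) * Complex.I - v * c ^ 2 / 2 : ℂ) = ((-(c ^ 2 * v / 2) : ℝ) : ℂ) by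
    push_cast; ring, Complex.exp_ofReal_re]

/-- The non-constant part of the mean of half the squared residual of a centred Gaussian variable,
as a function of its variance `v`. -/
noncomputable def residualEnergy (δ v : ℝ) : ℝ :=
  ∑' n : ℕ, δ ^ 2 / (2 * Real.pi ^ 2) * ((-1) ^ n / (n : ℝ) ^ 2) *
    Real.exp (-((2 * Real.pi * n / δ) ^ 2 * v / 2))

theorem summable_residualEnergy_coeff (δ : ℝ) :
    Summable fun n : ℕ => |δ ^ 2 / (2 * Real.pi ^ 2) * ((-1) ^ n / (n : ℝ) ^ 2)| := by
  have h := (Real.summable_one_div_nat_pow.2 one_lt_two).mul_left (δ ^ 2 / (2 * Real.pi ^ 2))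
  refine h.congr fun n => ?_
  have hpos : 0 ≤ δ ^ 2 / (2 * Real.pi ^ 2) := by positivity
  rw [abs_mul, abs_div ((-1) ^ n), abs_of_nonneg hpos, abs_pow, abs_neg, abs_one, one_pow, abs_sq]

theorem integral_half_quantResidual_sq_gaussianReal {δ : ℝ} (hδ : 0 < δ) (v : NNReal) :
    ∫ t, quantResidual δ t ^ 2 / 2 ∂(gaussianReal 0 v) = residualEnergy δ v + δ ^ 2 / 24 := by
  have hF : ∀ n : ℕ, Integrable (fun t : ℝ => δ ^ 2 / (2 * Real.pi ^ 2) * ((-1) ^ n / (n : ℝ) ^ 2) *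
      Real.cos (2 * Real.pi * n / δ * t)) (gaussianReal 0 v) := fun n =>
    Integrable.of_bound (C := |δ ^ 2 / (2 * Real.pi ^ 2) * ((-1) ^ n / (n : ℝ) ^ 2)|) (by fun_prop)
      (.of_forall fun t => by
        rw [Real.norm_eq_abs, abs_mul]
        exact mul_le_of_le_one_right (abs_nonneg _) (Real.abs_cos_le_one _))
  have hS : Summable fun n : ℕ => ∫ t : ℝ, ‖δ ^ 2 / (2 * Real.pi ^ 2) * ((-1) ^ n / (n : ℝ) ^ 2) *
      Real.cos (2 * Real.pi * n / δ * t)‖ ∂(gaussianReal 0 v) := by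
    refine Summable.of_nonneg_of_le (fun n => integral_nonneg fun t => norm_nonneg _) (fun n => ?_)
      (summable_residualEnergy_coeff δ)
    refine (integral_mono (hF n).norm (integrable_const
      |δ ^ 2 / (2 * Real.pi ^ 2) * ((-1) ^ n / (n : ℝ) ^ 2)|) fun t => ?_).trans (le_of_eq ?_)
    · dsimp only
      rw [Real.norm_eq_abs, abs_mul]
      exact mul_le_of_le_one_right (abs_nonneg _) (Real.abs_cos_le_one _)
    · simp
  have h := (hasSum_integral_of_summable_integral_norm hF hS).tsum_eq
  simp_rw [integral_const_mul, integral_cos_gaussianReal,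
    (hasSum_half_quantResidual_sq hδ _).tsum_eq] at h
  have hint : Integrable (fun t => quantResidual δ t ^ 2 / 2) (gaussianReal 0 v) := by
    refine Integrable.of_bound (C := (δ / 2) ^ 2 / 2)
      (((measurable_quantResidual δ).pow_const 2).div_const 2).aestronglyMeasurable
      (.of_forall fun t => ?_)
    have := abs_quantResidual_le hδ t
    rw [Real.norm_eq_abs, abs_div, abs_pow, abs_two]
    gcongr
  rw [integral_sub hint (integrable_const _)] at h
  simp only [integral_const, probReal_univ, one_smul] at h
  rw [residualEnergy, h]
  ring

/-- Termwise differentiation cancels the coefficients `n⁻²` of the Fourier series. -/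
theorem hasDerivAt_residualEnergy {δ : ℝ} (hδ : 0 < δ) {v : ℝ} (hv : 0 < v) :
    HasDerivAt (residualEnergy δ)
      (∑' n : ℕ, (-1 : ℝ) ^ n *
        Real.exp (-(2 * Real.pi ^ 2 * v / δ ^ 2 * ((n : ℝ) + 1) ^ 2))) v := by
  have hpi := Real.pi_pos
  set b : ℝ := 2 * Real.pi ^ 2 / δ ^ 2 with hb
  have hb0 : 0 < b := by positivity
  have hterm : ∀ (n : ℕ) (y : ℝ), HasDerivAt
      (fun y => δ ^ 2 / (2 * Real.pi ^ 2) * ((-1) ^ n / (n : ℝ) ^ 2) *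
        Real.exp (-((2 * Real.pi * n / δ) ^ 2 * y / 2)))
      (if n = 0 then 0 else (-1) ^ (n + 1) * Real.exp (-(b * n ^ 2 * y))) y := by
    intro n y
    have h1 : HasDerivAt (fun y : ℝ => -((2 * Real.pi * n / δ) ^ 2 * y / 2))
        (-((2 * Real.pi * n / δ) ^ 2 / 2)) y := by
      have := (((hasDerivAt_id y).const_mul ((2 * Real.pi * n / δ) ^ 2)).div_const 2).neg
      refine this.congr_deriv ?_
      simp
    refine (h1.exp.const_mul (δ ^ 2 / (2 * Real.pi ^ 2) * ((-1) ^ n / (n : ℝ) ^ 2))).congr_deriv ?_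
    split_ifs with hn
    · simp [hn]
    · have hn' : (n : ℝ) ≠ 0 := by exact_mod_cast hn
      rw [show -((2 * Real.pi * n / δ) ^ 2 * y / 2) = -(b * n ^ 2 * y) by rw [hb]; field_simp]
      field_simp
      ring
  have hsumm : ∀ c : ℝ, 0 < c → Summable fun n : ℕ => Real.exp (-(c * (n : ℝ))) := fun c hc => by
    refine (summable_geometric_of_lt_one (Real.exp_pos (-c)).le (by simpa using hc)).congr
      fun n => ?_
    rw [← Real.exp_nat_mul]
    ring_nf
  have hbound : ∀ (n : ℕ) (y : ℝ), y ∈ Set.Ioi (v / 2) →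
      ‖(if n = 0 then 0 else (-1) ^ (n + 1) * Real.exp (-(b * n ^ 2 * y)) : ℝ)‖ ≤
        Real.exp (-(b * (v / 2) * n)) := by
    intro n y hy
    split_ifs with hn
    · simp [Real.exp_nonneg]
    · rw [norm_mul, norm_pow, norm_neg, norm_one, one_pow, one_mul, Real.norm_eq_abs, Real.abs_exp]
      have hn1 : (1 : ℝ) ≤ n := by exact_mod_cast Nat.one_le_iff_ne_zero.2 hn
      have hy' : v / 2 ≤ y := (Set.mem_Ioi.1 hy).le
      have h2 : (n : ℝ) ≤ n ^ 2 := by nlinarith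
      have h3 : (v / 2) * n ≤ y * n ^ 2 := by
        have : 0 ≤ y := by linarith
        gcongr
      have h4 := mul_le_mul_of_nonneg_left h3 hb0.le
      refine Real.exp_le_exp.2 ?_
      linarith
  have hmem : v ∈ Set.Ioi (v / 2) := by simp [hv]
  have hsum0 : Summable fun n : ℕ => δ ^ 2 / (2 * Real.pi ^ 2) * ((-1) ^ n / (n : ℝ) ^ 2) *
        Real.exp (-((2 * Real.pi * n / δ) ^ 2 * v / 2)) := by
    refine Summable.of_norm_bounded (summable_residualEnergy_coeff δ) fun n => ?_
    rw [norm_mul, Real.norm_eq_abs, Real.norm_eq_abs, Real.abs_exp]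
    refine mul_le_of_le_one_right (abs_nonneg _) (Real.exp_le_one_iff.2 ?_)
    have : 0 ≤ (2 * Real.pi * n / δ) ^ 2 * v / 2 := by positivity
    linarith
  have h := hasDerivAt_tsum_of_isPreconnected (hsumm (b * (v / 2)) (by positivity)) isOpen_Ioi
    isPreconnected_Ioi (fun n y _ => hterm n y) hbound hmem hsum0 hmem
  refine h.congr_deriv ?_
  have hs : Summable fun n : ℕ => (if n = 0 then 0 else
      (-1) ^ (n + 1) * Real.exp (-(b * n ^ 2 * v)) : ℝ) :=
    Summable.of_norm_bounded (hsumm (b * (v / 2)) (by positivity)) fun n => hbound n v hmem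
  rw [hs.tsum_eq_zero_add]
  simp only [if_true, zero_add, Nat.add_eq_zero_iff, one_ne_zero, and_false, if_false]
  refine tsum_congr fun n => ?_
  rw [pow_add, pow_add, hb]
  push_cast
  ring_nf

theorem integrable_mul_quantResidual {ι : Type*} [Fintype ι] {δ : ℝ} (hδ : 0 < δ) (x : ι → ℝ)
    (i : ι) : Integrable (fun g : ι → ℝ => g i * quantResidual δ (g ⬝ᵥ x)) (stdGaussianPi ι) := by
  refine (integrable_eval_stdGaussianPi i).mul_bdd (c := δ / 2) ?_
    (.of_forall fun g => abs_quantResidual_le hδ _)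
  exact ((measurable_quantResidual δ).comp (measurable_dotProduct_const _)).aestronglyMeasurable

/-- The first-order Fourier-Gauss identity behind the error bounds: it is obtained by
differentiating the mean of half the squared residual of `⟨g, x⟩` in the `i`-th coordinate of `x`,
once under the integral and once through the Fourier series. -/
theorem integral_mul_quantResidual {ι : Type*} [Fintype ι] {δ : ℝ} (hδ : 0 < δ) {x : ι → ℝ}
    (hx : x ≠ 0) (i : ι) :
    ∫ g, g i * quantResidual δ (g ⬝ᵥ x) ∂(stdGaussianPi ι) =
      2 * (∑' n : ℕ, (-1 : ℝ) ^ n *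
        Real.exp (-(2 * Real.pi ^ 2 * (x ⬝ᵥ x) / δ ^ 2 * ((n : ℝ) + 1) ^ 2))) * x i := by
  classical
  have hxx : 0 < x ⬝ᵥ x := by
    refine lt_of_le_of_ne (Finset.sum_nonneg fun i _ => mul_self_nonneg _) ?_
    exact fun h => hx (dotProduct_self_eq_zero.1 h.symm)
  have hmeas : ∀ y : ι → ℝ, Measurable fun g : ι → ℝ => quantResidual δ (g ⬝ᵥ y) := fun y =>
    (measurable_quantResidual δ).comp (measurable_dotProduct_const _)
  have hshift : ∀ (g : ι → ℝ) (s : ℝ), g ⬝ᵥ (x + s • Pi.single i 1) = g ⬝ᵥ x + s * g i := by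
    intro g s
    simp [dotProduct_add, dotProduct_smul]
  have hnorm : ∀ s : ℝ, (x + s • Pi.single i 1) ⬝ᵥ (x + s • Pi.single i 1) =
      x ⬝ᵥ x + 2 * s * x i + s ^ 2 := by
    intro s
    simp [dotProduct_add, add_dotProduct, dotProduct_smul, smul_dotProduct]
    ring
  have hval : ∀ s : ℝ, ∫ g, quantResidual δ (g ⬝ᵥ x + s * g i) ^ 2 / 2 ∂(stdGaussianPi ι) =
      residualEnergy δ (x ⬝ᵥ x + 2 * s * x i + s ^ 2) + δ ^ 2 / 24 := by
    intro s
    have h0 : 0 ≤ (x + s • Pi.single i 1) ⬝ᵥ (x + s • Pi.single i 1) :=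
      Finset.sum_nonneg fun i _ => mul_self_nonneg _
    have h := (hasLaw_dotProduct_stdGaussianPi (x + s • Pi.single i 1)).integral_comp
      (f := fun t => quantResidual δ t ^ 2 / 2)
      (((measurable_quantResidual δ).pow_const 2).div_const 2).aestronglyMeasurable
    rw [integral_half_quantResidual_sq_gaussianReal hδ, Real.coe_toNNReal _ h0, hnorm] at h
    rw [← h]
    simp [hshift]
  have hR : HasDerivAt (fun s : ℝ => residualEnergy δ (x ⬝ᵥ x + 2 * s * x i + s ^ 2) + δ ^ 2 / 24)
      (2 * (∑' n : ℕ, (-1 : ℝ) ^ n *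
        Real.exp (-(2 * Real.pi ^ 2 * (x ⬝ᵥ x) / δ ^ 2 * ((n : ℝ) + 1) ^ 2))) * x i) 0 := by
    have hin : HasDerivAt (fun s : ℝ => x ⬝ᵥ x + 2 * s * x i + s ^ 2) (2 * x i) 0 := by
      have h1 := ((((hasDerivAt_id (0 : ℝ)).const_mul 2).mul_const (x i)).const_add (x ⬝ᵥ x)).add
        ((hasDerivAt_id (0 : ℝ)).pow 2)
      refine h1.congr_deriv ?_
      simp
    have h0 : x ⬝ᵥ x + 2 * 0 * x i + 0 ^ 2 = x ⬝ᵥ x := by ring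
    have hout := hasDerivAt_residualEnergy hδ hxx
    rw [← h0] at hout
    refine ((hout.comp (0 : ℝ) hin).add_const (δ ^ 2 / 24)).congr_deriv ?_
    rw [h0]
    ring
  -- The jumps of the residual form a countable set, which `⟨g, x⟩` almost surely avoids.
  have hbad : ∀ᵐ g ∂(stdGaussianPi ι), g ⬝ᵥ x ∉ Set.range fun n : ℤ => n * δ + δ / 2 := by
    have hv : (x ⬝ᵥ x).toNNReal ≠ 0 := by simpa using hxx
    have := nullSingletonClass_gaussianReal (μ := 0) hv
    have hc : (Set.range fun n : ℤ => n * δ + δ / 2).Countable := Set.countable_range _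
    have h := hc.ae_notMem (gaussianReal 0 (x ⬝ᵥ x).toNNReal)
    rw [← (hasLaw_dotProduct_stdGaussianPi x).map_eq] at h
    exact ae_of_ae_map (hasLaw_dotProduct_stdGaussianPi x).aemeasurable h
  have hLint : Integrable (fun g : ι → ℝ => δ * |g i|) (stdGaussianPi ι) :=
    (integrable_eval_stdGaussianPi i).abs.const_mul δ
  have hL := (hasDerivAt_integral_of_dominated_loc_of_lip
    (μ := stdGaussianPi ι)
    (F := fun (s : ℝ) (g : ι → ℝ) => quantResidual δ (g ⬝ᵥ x + s * g i) ^ 2 / 2)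
    (F' := fun g => g i * quantResidual δ (g ⬝ᵥ x)) (x₀ := 0) (bound := fun g => δ * |g i|)
    Filter.univ_mem (.of_forall fun s => by
      have := hmeas (x + s • Pi.single i 1)
      simp_rw [hshift] at this
      exact ((this.pow_const 2).div_const 2).aestronglyMeasurable)
    (by
      refine Integrable.of_bound (C := (δ / 2) ^ 2 / 2) ?_ (.of_forall fun t => ?_)
      · simp only [zero_mul, add_zero]
        exact (((hmeas x).pow_const 2).div_const 2).aestronglyMeasurable
      · rw [Real.norm_eq_abs, abs_div, abs_pow, abs_two]
        have := abs_quantResidual_le hδ (t ⬝ᵥ x + 0 * t i)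
        gcongr)
    (integrable_mul_quantResidual hδ x i).aestronglyMeasurable
    (.of_forall fun g => LipschitzOnWith.of_dist_le_mul fun s _ t _ => by
      rw [Real.dist_eq, Real.dist_eq]
      refine (abs_half_quantResidual_sq_sub_le hδ _ _).trans (le_of_eq ?_)
      rw [show g ⬝ᵥ x + s * g i - (g ⬝ᵥ x + t * g i) = g i * (s - t) by ring, abs_mul]
      simp [abs_of_pos hδ]
      ring)
    hLint
    (by
      filter_upwards [hbad] with g hg
      have h1 : HasDerivAt (fun s : ℝ => g ⬝ᵥ x + s * g i) (g i) 0 := by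
        simpa using ((hasDerivAt_id (0 : ℝ)).mul_const (g i)).const_add (g ⬝ᵥ x)
      have h0 : g ⬝ᵥ x + 0 * g i = g ⬝ᵥ x := by ring
      have h2 := hasDerivAt_half_quantResidual_sq hδ hg
      rw [← h0] at h2
      refine (h2.comp (0 : ℝ) h1).congr_deriv ?_
      rw [h0]
      ring)).2
  simp_rw [hval] at hL
  exact hL.unique hR

/-- The mean of `g ⋅ r(⟨g, x⟩)` is a multiple of `x`, with a factor governed by an alternating
series. -/
theorem exists_integral_mul_quantResidual_eq {ι : Type*} [Fintype ι] {δ : ℝ} (hδ : 0 < δ)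
    (x : ι → ℝ) :
    ∃ D : ℝ, 2 * (Real.exp (-(2 * Real.pi ^ 2 * (x ⬝ᵥ x) / δ ^ 2)) -
        Real.exp (-(8 * Real.pi ^ 2 * (x ⬝ᵥ x) / δ ^ 2))) ≤ D ∧
      D ≤ 2 * Real.exp (-(2 * Real.pi ^ 2 * (x ⬝ᵥ x) / δ ^ 2)) ∧
      ∀ i, ∫ g, g i * quantResidual δ (g ⬝ᵥ x) ∂(stdGaussianPi ι) = D * x i := by
  by_cases hx : x = 0
  · have h0 : quantResidual δ 0 = 0 := by
      rw [quantResidual, (scalarQuantizer_eq_iff hδ 0 0).2 (by constructor <;> simp <;> linarith)]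
      simp
    -- At `x = 0` the residual vanishes and every `D` works; `0` is within the bounds.
    exact ⟨0, by simp [hx], by simp [hx], fun i => by simp [hx, h0]⟩
  · have hxx : 0 < x ⬝ᵥ x := by
      refine lt_of_le_of_ne (Finset.sum_nonneg fun i _ => mul_self_nonneg _) ?_
      exact fun h => hx (dotProduct_self_eq_zero.1 h.symm)
    have hpi := Real.pi_pos
    have h := tsum_alternating_exp_sq_bounds (a := 2 * Real.pi ^ 2 * (x ⬝ᵥ x) / δ ^ 2)
      (by positivity)
    rw [show 4 * (2 * Real.pi ^ 2 * (x ⬝ᵥ x) / δ ^ 2) = 8 * Real.pi ^ 2 * (x ⬝ᵥ x) / δ ^ 2 by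
      ring] at h
    exact ⟨_, by linarith [h.1], by linarith [h.2], integral_mul_quantResidual hδ hx⟩

/-! ### Sub-Gaussian concentration -/

/-- A variable dominated by a multiple of a standard Gaussian is sub-Gaussian after centring.
If `φ` is its moment generating function, Jensen's inequality bounds that of the centred variable
by `φ(t) φ(-t) ≤ ((φ(t) + φ(-t)) / 2)²`, and the right-hand side is monotone in the absolute value
of the variable. -/
theorem hasSubgaussianMGF_sub_integral_of_abs_le {Ω : Type*} [MeasurableSpace Ω] {P : Measure Ω}
    [IsProbabilityMeasure P] {X Z : Ω → ℝ} {b : NNReal} (hX : AEMeasurable X P)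
    (hZ : HasLaw Z (gaussianReal 0 1) P) (h : ∀ ω, |X ω| ≤ b * |Z ω|) :
    HasSubgaussianMGF (fun ω => X ω - ∫ ω', X ω' ∂P) (2 * b ^ 2) P := by
  have hZint : ∀ t : ℝ, Integrable (fun ω => Real.exp (t * Z ω)) P := fun t => by
    have h1 := integrable_exp_mul_gaussianReal (μ := 0) (v := 1) t
    rw [← hZ.map_eq] at h1
    exact h1.comp_aemeasurable hZ.aemeasurable
  have hZmgf : ∀ t : ℝ, ∫ ω, Real.exp (t * Z ω) ∂P = Real.exp (t ^ 2 / 2) := fun t => by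
    have := mgf_gaussianReal hZ.map_eq t
    rw [mgf] at this
    rw [this]
    simp
  have hdom : ∀ (t : ℝ) (ω : Ω), Real.exp (t * X ω) + Real.exp (-t * X ω) ≤
      Real.exp (t * b * Z ω) + Real.exp (-(t * b) * Z ω) := by
    intro t ω
    have hc : Real.cosh (t * X ω) ≤ Real.cosh (t * b * Z ω) := by
      rw [Real.cosh_le_cosh, abs_mul, abs_mul, abs_mul, NNReal.abs_eq, mul_assoc]
      exact mul_le_mul_of_nonneg_left (h ω) (abs_nonneg t)
    rw [Real.cosh_eq, Real.cosh_eq] at hc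
    rw [neg_mul, neg_mul]
    linarith
  have hXint : ∀ t : ℝ, Integrable (fun ω => Real.exp (t * X ω)) P := fun t => by
    refine ((hZint (t * b)).add (hZint (-(t * b)))).mono' (by fun_prop) (.of_forall fun ω => ?_)
    rw [Real.norm_eq_abs, Real.abs_exp]
    exact le_trans (by linarith [Real.exp_pos (-t * X ω)]) (hdom t ω)
  have hXi : Integrable X P := by
    refine ((hXint 1).add (hXint (-1))).mono' hX.aestronglyMeasurable (.of_forall fun ω => ?_)
    rw [Real.norm_eq_abs, Pi.add_apply]
    refine abs_le.2 ⟨?_, ?_⟩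
    · linarith [Real.exp_pos (1 * X ω), Real.add_one_le_exp (-1 * X ω)]
    · linarith [Real.exp_pos (-1 * X ω), Real.add_one_le_exp (1 * X ω)]
  set M := ∫ ω', X ω' ∂P with hM
  have hexp : ∀ (t : ℝ) (ω : Ω), Real.exp (t * (X ω - M)) = Real.exp (-(t * M)) *
      Real.exp (t * X ω) := fun t ω => by
    rw [← Real.exp_add]
    ring_nf
  have hXM : Integrable (fun ω => X ω - M) P := hXi.sub (integrable_const M)
  have hJensen : ∀ t : ℝ, Real.exp (t * M) ≤ ∫ ω, Real.exp (t * X ω) ∂P := by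
    intro t
    have h1 : ∫ ω, (1 + t * (X ω - M)) ∂P ≤ ∫ ω, Real.exp (t * (X ω - M)) ∂P := by
      refine integral_mono ((integrable_const _).add (hXM.const_mul t))
        (by simp_rw [hexp]; exact (hXint t).const_mul _) fun ω => ?_
      linarith [Real.add_one_le_exp (t * (X ω - M))]
    rw [integral_add (integrable_const _) (hXM.const_mul t),
      integral_const_mul, integral_sub hXi (integrable_const _), ← hM] at h1
    simp_rw [hexp, integral_const_mul] at h1
    simp only [integral_const, probReal_univ, one_smul, sub_self, mul_zero, add_zero] at h1
    rw [Real.exp_neg, ← div_eq_inv_mul, le_div_iff₀ (Real.exp_pos _)] at h1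
    linarith
  refine ⟨fun t => ?_, fun t => ?_⟩
  · simp_rw [hexp]
    exact (hXint t).const_mul _
  · set p := ∫ ω, Real.exp (t * X ω) ∂P with hp
    set q := ∫ ω, Real.exp (-t * X ω) ∂P with hq
    have hpq : p + q ≤ 2 * Real.exp ((t * b) ^ 2 / 2) := by
      rw [hp, hq, ← integral_add (hXint t) (hXint (-t))]
      refine (integral_mono ((hXint t).add (hXint (-t)))
        ((hZint (t * b)).add (hZint (-(t * b)))) (hdom t)).trans (le_of_eq ?_)
      simp only [Pi.add_apply]
      rw [integral_add (hZint _) (hZint _), hZmgf, hZmgf]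
      ring_nf
    have hp0 : 0 ≤ p := integral_nonneg fun ω => (Real.exp_pos _).le
    have hq0 : 0 ≤ q := integral_nonneg fun ω => (Real.exp_pos _).le
    calc mgf (fun ω => X ω - M) P t = Real.exp (-t * M) * p := by
          rw [mgf]
          simp_rw [hexp, integral_const_mul]
          rw [neg_mul]
      _ ≤ q * p := by gcongr; exact hJensen (-t)
      _ ≤ ((p + q) / 2) ^ 2 := by nlinarith [sq_nonneg (p - q)]
      _ ≤ Real.exp ((t * b) ^ 2 / 2) ^ 2 := by gcongr; linarith
      _ = Real.exp (((2 * b ^ 2 : NNReal) : ℝ) * t ^ 2 / 2) := by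
          rw [← Real.exp_nat_mul]
          push_cast
          ring_nf

/-! ### The rows of a Gaussian matrix -/

namespace IsGaussianMatrix

variable {Ω : Type*} [MeasurableSpace Ω] {P : Measure Ω} [IsProbabilityMeasure P] {m k : ℕ}
  {E : Ω → Matrix (Fin m) (Fin k) ℝ}

theorem hasLaw_row (hE : IsGaussianMatrix E P) (j : Fin m) :
    HasLaw (fun ω => E ω j) (stdGaussianPi (Fin k)) P := by
  have hm : ∀ i, AEMeasurable (fun ω => E ω j i) P := fun i => (hE.hasLaw j i).aemeasurable
  refine ⟨aemeasurable_pi_iff.2 hm, ?_⟩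
  have hind : ProbabilityTheory.iIndepFun (fun (i : Fin k) ω => E ω j i) P :=
    hE.iIndepFun.precomp (g := fun i : Fin k => (j, i)) fun a b h => by simpa using h
  have h := (iIndepFun_iff_map_fun_eq_infinitePi_map₀' hm).1 hind
  simp_rw [(hE.hasLaw j _).map_eq, Measure.infinitePi_eq_pi] at h
  exact h

theorem iIndepFun_row (hE : IsGaussianMatrix E P) :
    ProbabilityTheory.iIndepFun (fun (j : Fin m) ω => E ω j) P := by
  have hm : ∀ p : Fin m × Fin k, AEMeasurable (fun ω => E ω p.1 p.2) P := fun p =>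
    (hE.hasLaw p.1 p.2).aemeasurable
  have h := (iIndepFun_iff_map_fun_eq_infinitePi_map₀' hm).1 hE.iIndepFun
  simp_rw [(hE.hasLaw _ _).map_eq] at h
  refine (iIndepFun_iff_map_fun_eq_infinitePi_map₀' fun j => (hE.hasLaw_row j).aemeasurable).2 ?_
  have hc := Measure.infinitePi_map_curry (fun (_ : Fin m) (_ : Fin k) => gaussianReal 0 1)
  rw [← h, AEMeasurable.map_map_of_aemeasurable (by fun_prop) (aemeasurable_pi_iff.2 hm)] at hc
  simp_rw [(hE.hasLaw_row _).map_eq]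
  simp_rw [Measure.infinitePi_eq_pi (ι := Fin k)] at hc
  exact hc

/-- Concentration of the coordinates of `Eᵀ r(E x)` around their means. -/
theorem measure_abs_sum_mul_quantResidual_sub_ge_le (hE : IsGaussianMatrix E P) {δ : ℝ}
    (hδ : 0 < δ) (x : Fin k → ℝ) (i : Fin k) {τ : ℝ} (hτ : 0 ≤ τ) :
    P.real {ω | τ ≤ |∑ j, E ω j i * quantResidual δ (E ω j ⬝ᵥ x) -
        m * ∫ g, g i * quantResidual δ (g ⬝ᵥ x) ∂(stdGaussianPi (Fin k))|} ≤
      2 * Real.exp (-τ ^ 2 / (m * δ ^ 2)) := by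
  set M := ∫ g, g i * quantResidual δ (g ⬝ᵥ x) ∂(stdGaussianPi (Fin k)) with hM
  have hf : Measurable fun g : Fin k → ℝ => g i * quantResidual δ (g ⬝ᵥ x) :=
    (measurable_pi_apply i).mul
      ((measurable_quantResidual δ).comp (measurable_dotProduct_const x))
  have hrow := hE.iIndepFun_row.comp₀
    (fun _ g => g i * quantResidual δ (g ⬝ᵥ x) - M) (fun j => (hE.hasLaw_row j).aemeasurable)
    fun j => (hf.sub_const M).aemeasurable
  have hmean : ∀ j, ∫ ω, E ω j i * quantResidual δ (E ω j ⬝ᵥ x) ∂P = M := fun j =>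
    (hE.hasLaw_row j).integral_comp hf.aestronglyMeasurable
  have hsub : ∀ j, HasSubgaussianMGF
      (fun ω => E ω j i * quantResidual δ (E ω j ⬝ᵥ x) - M) (2 * (δ / 2).toNNReal ^ 2) P := by
    intro j
    have h := hasSubgaussianMGF_sub_integral_of_abs_le (P := P) (b := (δ / 2).toNNReal)
      (X := fun ω => E ω j i * quantResidual δ (E ω j ⬝ᵥ x)) (Z := fun ω => E ω j i)
      (hf.comp_aemeasurable (hE.hasLaw_row j).aemeasurable) (hE.hasLaw j i) fun ω => by
        rw [abs_mul, mul_comm, Real.coe_toNNReal _ (by positivity)]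
        gcongr
        exact abs_quantResidual_le hδ _
    rwa [hmean] at h
  have hc : ((∑ _j : Fin m, 2 * (δ / 2).toNNReal ^ 2 : NNReal) : ℝ) = m * δ ^ 2 / 2 := by
    simp only [Finset.sum_const, Finset.card_univ, Fintype.card_fin, nsmul_eq_mul]
    push_cast
    rw [Real.coe_toNNReal _ (by positivity)]
    ring
  have hsum := HasSubgaussianMGF.sum_of_iIndepFun hrow (s := Finset.univ)
    (c := fun _ => 2 * (δ / 2).toNNReal ^ 2) fun j _ => hsub j
  have h1 := hsum.measure_ge_le hτ
  have h2 := hsum.neg.measure_ge_le hτ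
  rw [hc] at h1 h2
  have heq : ∀ ω, ∑ j, E ω j i * quantResidual δ (E ω j ⬝ᵥ x) - m * M =
      ∑ j, ((fun g : Fin k → ℝ => g i * quantResidual δ (g ⬝ᵥ x) - M) ∘ fun ω => E ω j) ω := by
    intro ω
    simp [Finset.sum_sub_distrib]
  have hsubset : {ω | τ ≤ |∑ j, E ω j i * quantResidual δ (E ω j ⬝ᵥ x) - m * M|} ⊆
      {ω | τ ≤ ∑ j, ((fun g : Fin k → ℝ => g i * quantResidual δ (g ⬝ᵥ x) - M) ∘
        fun ω => E ω j) ω} ∪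
      {ω | τ ≤ (-fun ω => ∑ j, ((fun g : Fin k → ℝ => g i * quantResidual δ (g ⬝ᵥ x) - M) ∘
        fun ω => E ω j) ω) ω} := by
    intro ω hω
    rw [Set.mem_ofPred_eq, heq, le_abs] at hω
    exact hω
  refine (measureReal_mono hsubset).trans ((measureReal_union_le _ _).trans ?_)
  refine (add_le_add h1 h2).trans (le_of_eq ?_)
  rw [show 2 * (m * δ ^ 2 / 2) = m * δ ^ 2 by ring]
  ring

end IsGaussianMatrix

/-! ### Chi-square tails -/

theorem integral_exp_mul_sq_gaussianReal {θ : ℝ} (hθ : θ < 1 / 2) :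
    ∫ t, Real.exp (θ * t ^ 2) ∂(gaussianReal 0 1) = √(1 / (1 - 2 * θ)) := by
  rw [integral_gaussianReal_eq_integral_smul one_ne_zero]
  have h : ∀ t : ℝ, gaussianPDFReal 0 1 t • Real.exp (θ * t ^ 2) =
      (√(2 * Real.pi))⁻¹ * Real.exp (-(1 / 2 - θ) * t ^ 2) := by
    intro t
    rw [gaussianPDFReal, smul_eq_mul, mul_assoc, ← Real.exp_add]
    simp
    ring_nf
    simp
  simp_rw [h, integral_const_mul, integral_gaussian]
  have hpi := Real.pi_pos
  rw [← Real.sqrt_inv, ← Real.sqrt_mul (by positivity)]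
  congr 1
  have : 1 - 2 * θ ≠ 0 := by linarith
  have : 1 / 2 - θ ≠ 0 := by linarith
  field_simp

namespace IsGaussianMatrix

variable {Ω : Type*} [MeasurableSpace Ω] {P : Measure Ω} [IsProbabilityMeasure P] {m k : ℕ}
  {E : Ω → Matrix (Fin m) (Fin k) ℝ}

theorem mgf_dotProduct_self_mulVec (hE : IsGaussianMatrix E P) {u : Fin k → ℝ} (hu : u ⬝ᵥ u = 1)
    {θ : ℝ} (hθ : θ < 1 / 2) :
    mgf (fun ω => (E ω *ᵥ u) ⬝ᵥ (E ω *ᵥ u)) P θ = √(1 / (1 - 2 * θ)) ^ m := by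
  have hf : Measurable fun g : Fin k → ℝ => (g ⬝ᵥ u) ^ 2 :=
    (measurable_dotProduct_const u).pow_const 2
  have hrow := hE.iIndepFun_row.comp₀ (fun _ g => (g ⬝ᵥ u) ^ 2)
    (fun j => (hE.hasLaw_row j).aemeasurable) fun j => hf.aemeasurable
  have hsum := hrow.mgf_sum₀ (t := θ)
    (fun j => hf.comp_aemeasurable (hE.hasLaw_row j).aemeasurable) Finset.univ
  have heq : (∑ j, (fun g : Fin k → ℝ => (g ⬝ᵥ u) ^ 2) ∘ fun ω => E ω j) =
      fun ω => (E ω *ᵥ u) ⬝ᵥ (E ω *ᵥ u) := by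
    ext ω
    rw [Finset.sum_apply]
    exact Finset.sum_congr rfl fun j _ => sq _
  rw [heq] at hsum
  rw [hsum]
  have hj : ∀ j, mgf ((fun g : Fin k → ℝ => (g ⬝ᵥ u) ^ 2) ∘ fun ω => E ω j) P θ =
      √(1 / (1 - 2 * θ)) := by
    intro j
    rw [mgf]
    have h1 := (hE.hasLaw_row j).integral_comp (f := fun g => Real.exp (θ * (g ⬝ᵥ u) ^ 2))
      (hf.const_mul θ).exp.aestronglyMeasurable
    have h2 := (hasLaw_dotProduct_stdGaussianPi u).integral_comp
      (f := fun t => Real.exp (θ * t ^ 2)) (by fun_prop)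
    rw [hu, Real.toNNReal_one, integral_exp_mul_sq_gaussianReal hθ] at h2
    exact h1.trans h2
  simp [hj]

theorem integrable_exp_mul_dotProduct_self_mulVec (hE : IsGaussianMatrix E P) {u : Fin k → ℝ}
    (hu : u ⬝ᵥ u = 1) {θ : ℝ} (hθ : θ < 1 / 2) :
    Integrable (fun ω => Real.exp (θ * ((E ω *ᵥ u) ⬝ᵥ (E ω *ᵥ u)))) P := by
  refine Integrable.of_integral_ne_zero ?_
  have h := hE.mgf_dotProduct_self_mulVec hu hθ
  rw [mgf] at h
  rw [h]
  have : 0 < 1 - 2 * θ := by linarith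
  positivity

/-- Chernoff bound for the upper tail of the chi-square variable `‖E u‖²`. -/
theorem measure_dotProduct_self_mulVec_ge_le (hE : IsGaussianMatrix E P) {u : Fin k → ℝ}
    (hu : u ⬝ᵥ u = 1) {θ : ℝ} (hθ0 : 0 ≤ θ) (hθ : θ < 1 / 2) (b : ℝ) :
    P.real {ω | b * m ≤ (E ω *ᵥ u) ⬝ᵥ (E ω *ᵥ u)} ≤
      (Real.exp (-(θ * b)) * √(1 / (1 - 2 * θ))) ^ m := by
  refine (measure_ge_le_exp_mul_mgf (b * m) hθ0
    (hE.integrable_exp_mul_dotProduct_self_mulVec hu hθ)).trans (le_of_eq ?_)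
  rw [hE.mgf_dotProduct_self_mulVec hu hθ, mul_pow, ← Real.exp_nat_mul]
  ring_nf

/-- Chernoff bound for the lower tail of the chi-square variable `‖E u‖²`. -/
theorem measure_dotProduct_self_mulVec_le_le (hE : IsGaussianMatrix E P) {u : Fin k → ℝ}
    (hu : u ⬝ᵥ u = 1) {θ : ℝ} (hθ : 0 ≤ θ) (a : ℝ) :
    P.real {ω | (E ω *ᵥ u) ⬝ᵥ (E ω *ᵥ u) ≤ a * m} ≤
      (Real.exp (θ * a) * √(1 / (1 + 2 * θ))) ^ m := by
  refine (measure_le_le_exp_mul_mgf (a * m) (neg_nonpos.2 hθ)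
    (hE.integrable_exp_mul_dotProduct_self_mulVec hu (by linarith))).trans (le_of_eq ?_)
  rw [hE.mgf_dotProduct_self_mulVec hu (by linarith), mul_pow, ← Real.exp_nat_mul]
  ring_nf

end IsGaussianMatrix

/-! ### Nets on the unit sphere -/

/-- Volume bound for separated subsets of the unit ball: the balls of radius `1 / (2 n)` around the
points are disjoint and lie in the ball of radius `1 + 1 / (2 n)`. -/
theorem card_le_of_pairwise_inv_le_norm_sub {F : Type*} [NormedAddCommGroup F] [NormedSpace ℝ F]
    [FiniteDimensional ℝ F] {n : ℕ} (hn : 0 < n) (s : Finset F) (hs : ∀ c ∈ s, ‖c‖ ≤ 1)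
    (h : ∀ c ∈ s, ∀ d ∈ s, c ≠ d → (n : ℝ)⁻¹ ≤ ‖c - d‖) :
    s.card ≤ (2 * n + 1) ^ Module.finrank ℝ F := by
  borelize F
  let μ : Measure F := Measure.addHaar
  have hn' : (0 : ℝ) < n := by exact_mod_cast hn
  set ρ : ℝ := (n : ℝ)⁻¹ / 2 with hρ
  have hρ0 : 0 < ρ := by positivity
  have hdisj : Set.Pairwise (s : Set F) (Function.onFun Disjoint fun c => Metric.ball c ρ) := by
    rintro c hc d hd hcd
    refine Metric.ball_disjoint_ball ?_
    rw [dist_eq_norm, hρ, add_halves]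
    exact h c hc d hd hcd
  have hsub : (⋃ c ∈ s, Metric.ball c ρ) ⊆ Metric.ball (0 : F) (1 + ρ) := by
    refine Set.iUnion₂_subset fun c hc => Metric.ball_subset_ball' ?_
    rw [dist_zero_right, add_comm]
    exact add_le_add_left (hs c hc) ρ
  have hvol : (s.card : ENNReal) * ENNReal.ofReal (ρ ^ Module.finrank ℝ F) * μ (Metric.ball 0 1) ≤
      ENNReal.ofReal ((1 + ρ) ^ Module.finrank ℝ F) * μ (Metric.ball 0 1) :=
    calc
      _ = μ (⋃ c ∈ s, Metric.ball c ρ) := by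
        rw [measure_biUnion_finset hdisj fun c _ => measurableSet_ball]
        simp only [μ.addHaar_ball_of_pos _ hρ0, Finset.sum_const, nsmul_eq_mul, mul_assoc]
      _ ≤ μ (Metric.ball (0 : F) (1 + ρ)) := measure_mono hsub
      _ = _ := μ.addHaar_ball_of_pos _ (by positivity)
  have hvol' := (ENNReal.mul_le_mul_iff_left (Metric.measure_ball_pos _ _ zero_lt_one).ne'
    measure_ball_lt_top.ne).1 hvol
  have hreal := ENNReal.toReal_le_of_le_ofReal (by positivity) hvol'
  rw [ENNReal.toReal_mul, ENNReal.toReal_natCast, ENNReal.toReal_ofReal (by positivity),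
    ← le_div_iff₀ (by positivity), ← div_pow] at hreal
  have hq : (1 + ρ) / ρ = ((2 * n + 1 : ℕ) : ℝ) := by
    rw [hρ]
    push_cast
    field_simp
  rw [hq] at hreal
  exact_mod_cast hreal

theorem exists_net_sphere (F : Type*) [NormedAddCommGroup F] [NormedSpace ℝ F]
    [FiniteDimensional ℝ F] {n : ℕ} (hn : 0 < n) :
    ∃ N : Finset F, N.card ≤ (2 * n + 1) ^ Module.finrank ℝ F ∧ (∀ v ∈ N, ‖v‖ = 1) ∧
      ∀ u : F, ‖u‖ = 1 → ∃ v ∈ N, ‖u - v‖ ≤ (n : ℝ)⁻¹ := by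
  classical
  set B := (2 * n + 1) ^ Module.finrank ℝ F with hB
  have hfin : ∀ s : Finset F, (s : Set F) ⊆ Metric.sphere 0 1 →
      Metric.IsSeparated ((n : NNReal)⁻¹ : NNReal) (s : Set F) → s.card ≤ B := by
    intro s hs hsep
    refine card_le_of_pairwise_inv_le_norm_sub hn s (fun c hc => ?_) fun c hc d hd hcd => ?_
    · have := hs hc
      simp only [mem_sphere_zero_iff_norm] at this
      exact this.le
    · have h1 : ((n : NNReal)⁻¹ : NNReal) < edist c d := hsep hc hd hcd
      rw [edist_nndist, ENNReal.coe_lt_coe, ← NNReal.coe_lt_coe, coe_nndist, dist_eq_norm] at h1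
      push_cast at h1
      exact h1.le
  have hpack : Metric.packingNumber (n : NNReal)⁻¹ (Metric.sphere (0 : F) 1) ≤ B := by
    refine iSup_le fun s => iSup₂_le fun hs hsep => ?_
    by_contra! hlt
    obtain ⟨t, hts, htc⟩ := Set.exists_subset_encard_eq (Order.add_one_le_of_lt hlt)
    have htf : t.Finite := Set.finite_of_encard_eq_coe (k := B + 1) (by simpa using htc)
    have h1 := hfin htf.toFinset (by simpa using hts.trans hs) (by simpa using hsep.subset hts)
    rw [htf.encard_eq_coe_toFinset_card] at htc
    have h2 : htf.toFinset.card = B + 1 := by exact_mod_cast htc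
    omega
  have htop : Metric.packingNumber (n : NNReal)⁻¹ (Metric.sphere (0 : F) 1) ≠ ⊤ :=
    ne_top_of_le_ne_top (ENat.natCast_ne_top B) hpack
  set M := Metric.maximalSeparatedSet (n : NNReal)⁻¹ (Metric.sphere (0 : F) 1) with hM
  have hMc : M.encard ≤ B := (Metric.encard_maximalSeparatedSet htop).trans_le hpack
  have hMf : M.Finite := Set.finite_of_encard_le_coe hMc
  refine ⟨hMf.toFinset, ?_, fun v hv => ?_, fun u hu => ?_⟩
  · rw [hMf.encard_eq_coe_toFinset_card] at hMc
    exact_mod_cast hMc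
  · have := Metric.maximalSeparatedSet_subset (hMf.mem_toFinset.1 hv)
    simpa using this
  · have hcov := Metric.isCover_iff_subset_iUnion_closedBall.1
      (Metric.isCover_maximalSeparatedSet htop)
    have hu' := hcov (mem_sphere_zero_iff_norm.2 hu)
    simp only [Set.mem_iUnion, Metric.mem_closedBall] at hu'
    obtain ⟨v, hv, huv⟩ := hu'
    refine ⟨v, hMf.mem_toFinset.2 hv, ?_⟩
    rw [dist_eq_norm] at huv
    simpa using huv

/-- A linear map that is controlled on a net of the unit sphere is controlled everywhere. -/
theorem bounds_of_bounds_on_net {F G : Type*} [NormedAddCommGroup F] [NormedSpace ℝ F]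
    [NormedAddCommGroup G] [NormedSpace ℝ G] (L : F →L[ℝ] G) {η a b : ℝ} (hη : η < 1)
    (hb0 : 0 ≤ b) (N : Set F) (hN : ∀ u : F, ‖u‖ = 1 → ∃ v ∈ N, ‖u - v‖ ≤ η)
    (ha : ∀ v ∈ N, a ≤ ‖L v‖) (hb : ∀ v ∈ N, ‖L v‖ ≤ b) (u : F) :
    (a - η * b / (1 - η)) * ‖u‖ ≤ ‖L u‖ ∧ ‖L u‖ ≤ b / (1 - η) * ‖u‖ := by
  have hη1 : 0 < 1 - η := by linarith
  have hdiff : ∀ u : F, ‖u‖ = 1 → ∃ v ∈ N, ‖L (u - v)‖ ≤ ‖L‖ * η := fun u hu => by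
    obtain ⟨v, hv, huv⟩ := hN u hu
    exact ⟨v, hv, (L.le_opNorm _).trans (by gcongr)⟩
  by_cases hu0 : u = 0
  · simp [hu0]
  have hu : 0 < ‖u‖ := norm_pos_iff.2 hu0
  have hη0 : 0 ≤ η := by
    obtain ⟨v, -, h⟩ := hN (‖u‖⁻¹ • u) (by rw [norm_smul, norm_inv, norm_norm]; field_simp)
    exact (norm_nonneg _).trans h
  have hop : ‖L‖ ≤ b / (1 - η) := by
    have h1 : ‖L‖ ≤ b + ‖L‖ * η := by
      refine L.opNorm_le_of_unit_norm (by positivity) fun w hw => ?_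
      obtain ⟨v, hv, hwv⟩ := hdiff w hw
      have h2 : L w = L v + L (w - v) := by rw [← map_add]; congr 1; abel
      rw [h2]
      exact (norm_add_le _ _).trans (add_le_add (hb v hv) hwv)
    rw [le_div_iff₀ hη1]
    linarith
  refine ⟨?_, (L.le_opNorm u).trans (by gcongr)⟩
  have hunit : ∀ w : F, ‖w‖ = 1 → a - η * b / (1 - η) ≤ ‖L w‖ := by
    intro w hw
    obtain ⟨v, hv, hwv⟩ := hdiff w hw
    have h2 : L v = L w - L (w - v) := by rw [← map_sub]; congr 1; abel
    have h3 : ‖L v‖ ≤ ‖L w‖ + ‖L (w - v)‖ := by rw [h2]; exact norm_sub_le _ _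
    have h4 : ‖L‖ * η ≤ η * b / (1 - η) := by
      rw [mul_comm, mul_div_assoc]
      gcongr
    linarith [ha v hv]
  have h5 := hunit (‖u‖⁻¹ • u) (by rw [norm_smul, norm_inv, norm_norm]; field_simp)
  rw [map_smul, norm_smul, norm_inv, norm_norm, ← div_eq_inv_mul, le_div_iff₀ hu] at h5
  exact h5

/-! ### Extreme singular values of a Gaussian matrix -/

theorem norm_toLp_sq_eq_dotProduct {ι : Type*} [Fintype ι] (v : ι → ℝ) :
    ‖WithLp.toLp 2 v‖ ^ 2 = v ⬝ᵥ v := by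
  rw [EuclideanSpace.real_norm_sq_eq]
  exact Finset.sum_congr rfl fun i _ => sq _

theorem dotProduct_le_norm_mul_norm {ι : Type*} [Fintype ι] (v w : ι → ℝ) :
    v ⬝ᵥ w ≤ ‖WithLp.toLp 2 v‖ * ‖WithLp.toLp 2 w‖ := by
  have h := real_inner_le_norm (WithLp.toLp 2 v) (WithLp.toLp 2 w)
  rwa [EuclideanSpace.inner_toLp_toLp, star_trivial, dotProduct_comm] at h

namespace IsGaussianMatrix

variable {Ω : Type*} [MeasurableSpace Ω] {P : Measure Ω} [IsProbabilityMeasure P] {m k : ℕ}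
  {E : Ω → Matrix (Fin m) (Fin k) ℝ}

/-- Union bound over a `1 / 100`-net of the unit sphere. -/
theorem measure_not_bounds_le (hE : IsGaussianMatrix E P) {a b s S θ θ' : ℝ}
    (hb : 0 ≤ b) (hθ0 : 0 ≤ θ) (hθ : θ < 1 / 2) (hθ' : 0 ≤ θ') (hs : s ≤ a - b / 99)
    (hS : 100 / 99 * b ≤ S) :
    P.real {ω | ¬ ∀ u : Fin k → ℝ,
        s * √m * ‖WithLp.toLp 2 u‖ ≤ ‖WithLp.toLp 2 (E ω *ᵥ u)‖ ∧
        ‖WithLp.toLp 2 (E ω *ᵥ u)‖ ≤ S * √m * ‖WithLp.toLp 2 u‖} ≤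
      201 ^ k * (Real.exp (θ' * a ^ 2) * √(1 / (1 + 2 * θ'))) ^ m +
      201 ^ k * (Real.exp (-(θ * b ^ 2)) * √(1 / (1 - 2 * θ))) ^ m := by
  obtain ⟨N, hcard, hN1, hN⟩ := exists_net_sphere (EuclideanSpace ℝ (Fin k))
    (n := 100) (by norm_num)
  rw [finrank_euclideanSpace_fin] at hcard
  have hcard' : (N.card : ℝ) ≤ 201 ^ k := by exact_mod_cast hcard
  have hm0 : (0 : ℝ) ≤ m := Nat.cast_nonneg m
  have hsub : {ω | ¬ ∀ u : Fin k → ℝ,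
        s * √m * ‖WithLp.toLp 2 u‖ ≤ ‖WithLp.toLp 2 (E ω *ᵥ u)‖ ∧
        ‖WithLp.toLp 2 (E ω *ᵥ u)‖ ≤ S * √m * ‖WithLp.toLp 2 u‖} ⊆
      (⋃ v ∈ N, {ω | (E ω *ᵥ v.ofLp) ⬝ᵥ (E ω *ᵥ v.ofLp) ≤ a ^ 2 * m}) ∪
      ⋃ v ∈ N, {ω | b ^ 2 * m ≤ (E ω *ᵥ v.ofLp) ⬝ᵥ (E ω *ᵥ v.ofLp)} := by
    intro ω hω
    by_contra hnot
    simp only [Set.mem_union, Set.mem_iUnion, Set.mem_ofPred_eq, not_or, not_exists, not_le] at hnot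
    refine hω fun u => ?_
    set L := LinearMap.toContinuousLinearMap (Matrix.toLpLin 2 2 (E ω)) with hL
    have hLa : ∀ w, L w = WithLp.toLp 2 (E ω *ᵥ w.ofLp) := fun w => Matrix.toLpLin_apply 2 2 _ _
    have hlow : ∀ v ∈ (N : Set (EuclideanSpace ℝ (Fin k))), a * √m ≤ ‖L v‖ := fun v hv => by
      have h := (hnot.1 v hv).le
      rw [← norm_toLp_sq_eq_dotProduct, ← hLa] at h
      refine abs_le_of_sq_le_sq' ?_ (norm_nonneg _) |>.2
      rwa [mul_pow, Real.sq_sqrt hm0]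
    have hupp : ∀ v ∈ (N : Set (EuclideanSpace ℝ (Fin k))), ‖L v‖ ≤ b * √m := fun v hv => by
      have h := (hnot.2 v hv).le
      rw [← norm_toLp_sq_eq_dotProduct, ← hLa] at h
      refine abs_le_of_sq_le_sq' ?_ (by positivity) |>.2
      rwa [mul_pow, Real.sq_sqrt hm0]
    have hfin := bounds_of_bounds_on_net L (η := ((100 : ℕ) : ℝ)⁻¹) (by norm_num) (by positivity)
      (N : Set (EuclideanSpace ℝ (Fin k))) hN hlow hupp (WithLp.toLp 2 u)
    rw [hLa] at hfin
    refine ⟨le_trans ?_ hfin.1, hfin.2.trans ?_⟩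
    · gcongr
      refine (mul_le_mul_of_nonneg_right hs (Real.sqrt_nonneg _)).trans (le_of_eq ?_)
      push_cast
      ring
    · gcongr
      refine le_trans (le_of_eq ?_) (mul_le_mul_of_nonneg_right hS (Real.sqrt_nonneg _))
      push_cast
      ring
  have hunit : ∀ v ∈ N, v.ofLp ⬝ᵥ v.ofLp = 1 := fun v hv => by
    rw [← norm_toLp_sq_eq_dotProduct, WithLp.toLp_ofLp, hN1 v hv, one_pow]
  refine (measureReal_mono hsub).trans ((measureReal_union_le _ _).trans (add_le_add ?_ ?_))
  · refine (measureReal_biUnion_finset_le _ _).trans ((Finset.sum_le_sum fun v hv =>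
      hE.measure_dotProduct_self_mulVec_le_le (hunit v hv) hθ' (a ^ 2)).trans ?_)
    rw [Finset.sum_const, nsmul_eq_mul]
    gcongr
  · refine (measureReal_biUnion_finset_le _ _).trans ((Finset.sum_le_sum fun v hv =>
      hE.measure_dotProduct_self_mulVec_ge_le (hunit v hv) hθ0 hθ (b ^ 2)).trans ?_)
    rw [Finset.sum_const, nsmul_eq_mul]
    gcongr

end IsGaussianMatrix

/-- The net has at most `201 ^ k ≤ exp (6 k)` points; if `k ≤ ρ m`, this is compensated by a tail
`q ^ m` with `q ≤ exp (-(1 / 8 + 6 ρ))`. -/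
theorem pow_mul_pow_le_exp_neg {m k : ℕ} {ρ q : ℝ} (hk : (k : ℝ) ≤ ρ * m) (hq0 : 0 ≤ q)
    (hq : q ≤ Real.exp (-(1 / 8 + 6 * ρ))) :
    201 ^ k * q ^ m ≤ Real.exp (-(m : ℝ) / 8) := by
  have h201 : (201 : ℝ) ≤ Real.exp 6 := by
    have h1 : (2.7 : ℝ) ≤ Real.exp 1 := by linarith [Real.exp_one_gt_d9]
    have h2 : Real.exp 6 = Real.exp 1 ^ 6 := by rw [← Real.exp_nat_mul]; norm_num
    rw [h2]
    exact le_trans (by norm_num) (pow_le_pow_left₀ (by norm_num) h1 6)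
  calc (201 : ℝ) ^ k * q ^ m ≤ Real.exp 6 ^ k * Real.exp (-(1 / 8 + 6 * ρ)) ^ m := by gcongr
    _ = Real.exp (-(m : ℝ) / 8 + 6 * (k - ρ * m)) := by
      rw [← Real.exp_nat_mul, ← Real.exp_nat_mul, ← Real.exp_add]
      ring_nf
    _ ≤ Real.exp (-(m : ℝ) / 8) := Real.exp_le_exp.2 (by linarith)

theorem sqrt_two_le_exp {y : ℝ} (hy : 0.34658 ≤ y) : √2 ≤ Real.exp y := by
  rw [Real.sqrt_le_left (Real.exp_pos _).le, ← Real.exp_nat_mul,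
    ← Real.log_le_iff_le_exp (by norm_num)]
  push_cast
  linarith [Real.log_two_lt_d9]

namespace IsGaussianMatrix

variable {Ω : Type*} [MeasurableSpace Ω] {P : Measure Ω} [IsProbabilityMeasure P] {m k : ℕ}
  {E : Ω → Matrix (Fin m) (Fin k) ℝ}

/-- For redundancy larger than `4` the singular values are bounded below by a fixed multiple
of `√m`. -/
theorem measure_not_bounds_le_of_four_mul_le (hE : IsGaussianMatrix E P) (hk : 4 * k ≤ m) :
    P.real {ω | ¬ ∀ u : Fin k → ℝ,
        1 / 20 * √m * ‖WithLp.toLp 2 u‖ ≤ ‖WithLp.toLp 2 (E ω *ᵥ u)‖ ∧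
        ‖WithLp.toLp 2 (E ω *ᵥ u)‖ ≤ 5 * √m * ‖WithLp.toLp 2 u‖} ≤
      2 * Real.exp (-(m : ℝ) / 8) := by
  have hk' : (k : ℝ) ≤ 1 / 4 * m := by
    have : (4 : ℝ) * k ≤ m := by exact_mod_cast hk
    linarith
  -- `θ' = 99 / 2` is chosen as the optimum `(a⁻² - 1) / 2`, which makes `1 + 2 θ'` a square.
  refine (hE.measure_not_bounds_le (a := 1 / 10) (b := 4) (θ := 1 / 4) (θ' := 99 / 2)
    (by norm_num) (by norm_num) (by norm_num) (by norm_num) (by norm_num)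
    (by norm_num)).trans ?_
  rw [two_mul (Real.exp _)]
  refine add_le_add (pow_mul_pow_le_exp_neg hk' (by positivity) ?_)
    (pow_mul_pow_le_exp_neg hk' (by positivity) ?_)
  · have h1 : √(1 / (1 + 2 * (99 / 2)) : ℝ) = 1 / 10 := by
      rw [show (1 / (1 + 2 * (99 / 2)) : ℝ) = (1 / 10) ^ 2 by norm_num,
        Real.sqrt_sq (by norm_num)]
    have h2 : Real.exp (11 / 5) ≤ 10 := by
      refine le_of_pow_le_pow_left₀ (n := 5) (by norm_num) (by norm_num) ?_
      rw [← Real.exp_nat_mul, show ((5 : ℕ) : ℝ) * (11 / 5) = (11 : ℕ) * 1 by norm_num,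
        Real.exp_nat_mul]
      exact (pow_le_pow_left₀ (Real.exp_pos _).le Real.exp_one_lt_d9.le 11).trans (by norm_num)
    rw [h1, ← div_eq_mul_one_div, div_le_iff₀ (by norm_num)]
    calc Real.exp (99 / 2 * (1 / 10) ^ 2)
        ≤ Real.exp (-(1 / 8 + 6 * (1 / 4))) * Real.exp (11 / 5) := by
          rw [← Real.exp_add]
          exact Real.exp_le_exp.2 (by norm_num)
      _ ≤ _ := by gcongr
  · rw [show (1 / (1 - 2 * (1 / 4)) : ℝ) = 2 by norm_num]
    calc _ ≤ Real.exp (-(1 / 4 * 4 ^ 2)) * Real.exp (19 / 8) := by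
          gcongr
          exact sqrt_two_le_exp (by norm_num)
      _ = _ := by
          rw [← Real.exp_add]
          norm_num

/-- For large redundancy the singular values lie between `√m / 2` and `3 √m / 2`. -/
theorem measure_not_bounds_le_of_mul_le (hE : IsGaussianMatrix E P) (hk : 200 * k ≤ m) :
    P.real {ω | ¬ ∀ u : Fin k → ℝ,
        1 / 2 * √m * ‖WithLp.toLp 2 u‖ ≤ ‖WithLp.toLp 2 (E ω *ᵥ u)‖ ∧
        ‖WithLp.toLp 2 (E ω *ᵥ u)‖ ≤ 3 / 2 * √m * ‖WithLp.toLp 2 u‖} ≤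
      2 * Real.exp (-(m : ℝ) / 8) := by
  have hk' : (k : ℝ) ≤ 1 / 200 * m := by
    have : (200 : ℝ) * k ≤ m := by exact_mod_cast hk
    linarith
  -- `a` and `b` leave room for the net error `b / 99`; both rates then exceed `1 / 8`.
  refine (hE.measure_not_bounds_le (a := 11 / 20) (b := 29 / 20) (θ := 1 / 4) (θ' := 3 / 2)
    (by norm_num) (by norm_num) (by norm_num) (by norm_num) (by norm_num)
    (by norm_num)).trans ?_
  rw [two_mul (Real.exp _)]
  refine add_le_add (pow_mul_pow_le_exp_neg hk' (by positivity) ?_)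
    (pow_mul_pow_le_exp_neg hk' (by positivity) ?_)
  · have h1 : √(1 / (1 + 2 * (3 / 2)) : ℝ) = 1 / 2 := by
      rw [show (1 / (1 + 2 * (3 / 2)) : ℝ) = (1 / 2) ^ 2 by norm_num, Real.sqrt_sq (by norm_num)]
    have h2 : Real.exp (0.61) ≤ 2 := by
      rw [← Real.le_log_iff_exp_le (by norm_num)]
      linarith [Real.log_two_gt_d9]
    rw [h1, ← div_eq_mul_one_div, div_le_iff₀ (by norm_num)]
    calc Real.exp (3 / 2 * (11 / 20) ^ 2)
        ≤ Real.exp (-(1 / 8 + 6 * (1 / 200))) * Real.exp (0.61) := by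
          rw [← Real.exp_add]
          exact Real.exp_le_exp.2 (by norm_num)
      _ ≤ _ := by gcongr
  · rw [show (1 / (1 - 2 * (1 / 4)) : ℝ) = 2 by norm_num]
    calc _ ≤ Real.exp (-(1 / 4 * (29 / 20) ^ 2)) * Real.exp (0.35) := by
          gcongr
          exact sqrt_two_le_exp (by norm_num)
      _ ≤ _ := by
          rw [← Real.exp_add]
          exact Real.exp_le_exp.2 (by norm_num)

end IsGaussianMatrix

/-! ### The reconstruction error through the normal equations -/

section Reconstruction

variable {m k : ℕ} {M : Matrix (Fin m) (Fin k) ℝ} {s : ℝ}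

theorem mulVec_injective_of_bound (hs0 : 0 < s)
    (hs : ∀ u : Fin k → ℝ, s * ‖WithLp.toLp 2 u‖ ≤ ‖WithLp.toLp 2 (M *ᵥ u)‖) :
    Function.Injective M.mulVec := by
  intro u v huv
  have h := hs (u - v)
  have h0 : M *ᵥ (u - v) = 0 := by rw [Matrix.mulVec_sub, sub_eq_zero]; exact huv
  rw [h0, WithLp.toLp_zero, norm_zero] at h
  have h1 : ‖WithLp.toLp 2 (u - v)‖ = 0 :=
    le_antisymm (nonpos_of_mul_nonpos_right h hs0) (norm_nonneg _)
  have h2 := norm_toLp_sq_eq_dotProduct (u - v)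
  rw [h1, zero_pow two_ne_zero] at h2
  exact sub_eq_zero.1 (dotProduct_self_eq_zero.1 h2.symm)

theorem rank_eq_of_mulVec_injective (h : Function.Injective M.mulVec) : M.rank = k := by
  rw [Matrix.rank, LinearMap.finrank_range_of_inj (f := M.mulVecLin) h]
  simp

theorem isUnit_det_transpose_mul_self (h : Function.Injective M.mulVec) :
    IsUnit (Mᵀ * M).det := by
  rw [← Matrix.isUnit_iff_isUnit_det, ← Matrix.mulVec_injective_iff_isUnit]
  intro u v huv
  have h0 : (Mᵀ * M) *ᵥ (u - v) = 0 := by rw [Matrix.mulVec_sub, sub_eq_zero]; exact huv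
  have h1 : (M *ᵥ (u - v)) ⬝ᵥ (M *ᵥ (u - v)) = 0 := by
    rw [← Matrix.mulVec_mulVec] at h0
    rw [Matrix.dotProduct_mulVec, Matrix.vecMul_mulVec, ← Matrix.mulVec_transpose,
      Matrix.transpose_mul, Matrix.transpose_transpose, ← Matrix.mulVec_mulVec, h0,
      zero_dotProduct]
  refine h (sub_eq_zero.1 ?_)
  rw [← Matrix.mulVec_sub]
  exact dotProduct_self_eq_zero.1 h1

variable (M) in
/-- The error vector `x - E† Q(E x)`. -/
noncomputable def errorVec (δ : ℝ) (x : Fin k → ℝ) : Fin k → ℝ := x - pinv M *ᵥ msq δ (M *ᵥ x)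

theorem reconstructionError_eq (δ : ℝ) (x : EuclideanSpace ℝ (Fin k)) :
    reconstructionError δ M x = ‖WithLp.toLp 2 (errorVec M δ x.ofLp)‖ := rfl

variable (M) in
/-- The vector of quantization residuals of the measurements. -/
noncomputable def residualVec (δ : ℝ) (x : Fin k → ℝ) : Fin m → ℝ :=
  fun j => quantResidual δ ((M *ᵥ x) j)

/-- The error vector solves the normal equations with the residual vector as right-hand side. -/
theorem transpose_mulVec_mulVec_errorVec (h : Function.Injective M.mulVec) (δ : ℝ)
    (x : Fin k → ℝ) : Mᵀ *ᵥ (M *ᵥ errorVec M δ x) = Mᵀ *ᵥ residualVec M δ x := by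
  have hr : residualVec M δ x = M *ᵥ x - msq δ (M *ᵥ x) := rfl
  rw [errorVec, hr, Matrix.mulVec_mulVec, Matrix.mulVec_sub, Matrix.mulVec_sub,
    Matrix.mulVec_mulVec, Matrix.mulVec_mulVec, pinv, Matrix.mul_nonsing_inv_cancel_left _ _
    (isUnit_det_transpose_mul_self h)]

theorem norm_residualVec_le {δ : ℝ} (hδ : 0 < δ) (x : Fin k → ℝ) :
    ‖WithLp.toLp 2 (residualVec M δ x)‖ ≤ √m * (δ / 2) := by
  refine abs_le_of_sq_le_sq' ?_ (by positivity) |>.2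
  rw [EuclideanSpace.real_norm_sq_eq, mul_pow, Real.sq_sqrt (Nat.cast_nonneg m)]
  refine (Finset.sum_le_card_nsmul _ _ ((δ / 2) ^ 2) fun j _ => ?_).trans (le_of_eq (by simp))
  have := abs_quantResidual_le hδ ((M *ᵥ x) j)
  exact sq_le_sq' (abs_le.1 this).1 (abs_le.1 this).2

theorem norm_sq_mulVec_errorVec (h : Function.Injective M.mulVec) (δ : ℝ) (x : Fin k → ℝ) :
    ‖WithLp.toLp 2 (M *ᵥ errorVec M δ x)‖ ^ 2 =
      errorVec M δ x ⬝ᵥ (Mᵀ *ᵥ residualVec M δ x) := by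
  rw [norm_toLp_sq_eq_dotProduct, ← transpose_mulVec_mulVec_errorVec h,
    Matrix.dotProduct_mulVec _ Mᵀ, Matrix.vecMul_transpose]

/-- Error bound that uses only the size of the residuals. -/
theorem mul_norm_errorVec_le (hs0 : 0 < s)
    (hs : ∀ u : Fin k → ℝ, s * ‖WithLp.toLp 2 u‖ ≤ ‖WithLp.toLp 2 (M *ᵥ u)‖) (δ : ℝ)
    (x : Fin k → ℝ) :
    s * ‖WithLp.toLp 2 (errorVec M δ x)‖ ≤ ‖WithLp.toLp 2 (residualVec M δ x)‖ := by
  have h1 := norm_sq_mulVec_errorVec (mulVec_injective_of_bound hs0 hs) δ x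
  rw [Matrix.dotProduct_mulVec, Matrix.vecMul_transpose] at h1
  have h2 := dotProduct_le_norm_mul_norm (M *ᵥ errorVec M δ x) (residualVec M δ x)
  have h3 : ‖WithLp.toLp 2 (M *ᵥ errorVec M δ x)‖ ≤ ‖WithLp.toLp 2 (residualVec M δ x)‖ := by
    rcases (norm_nonneg (WithLp.toLp 2 (M *ᵥ errorVec M δ x))).eq_or_lt with h0 | h0
    · rw [← h0]; exact norm_nonneg _
    · refine le_of_mul_le_mul_left ?_ h0
      rw [← sq, h1]
      exact h2
  exact (hs _).trans h3

/-- Error bound through `Eᵀ r`, in which the residuals may cancel. -/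
theorem sq_mul_norm_errorVec_le (hs0 : 0 < s)
    (hs : ∀ u : Fin k → ℝ, s * ‖WithLp.toLp 2 u‖ ≤ ‖WithLp.toLp 2 (M *ᵥ u)‖) (δ : ℝ)
    (x : Fin k → ℝ) :
    s ^ 2 * ‖WithLp.toLp 2 (errorVec M δ x)‖ ≤ ‖WithLp.toLp 2 (Mᵀ *ᵥ residualVec M δ x)‖ := by
  have h1 := norm_sq_mulVec_errorVec (mulVec_injective_of_bound hs0 hs) δ x
  have h2 := dotProduct_le_norm_mul_norm (errorVec M δ x) (Mᵀ *ᵥ residualVec M δ x)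
  have h3 := pow_le_pow_left₀ (by positivity) (hs (errorVec M δ x)) 2
  rcases (norm_nonneg (WithLp.toLp 2 (errorVec M δ x))).eq_or_lt with h0 | h0
  · rw [← h0, mul_zero]; exact norm_nonneg _
  · refine le_of_mul_le_mul_left ?_ h0
    nlinarith

/-- Matching lower bound for the error. -/
theorem norm_transpose_mulVec_residualVec_le {S : ℝ} (hinj : Function.Injective M.mulVec)
    (hS0 : 0 ≤ S) (hS : ∀ u : Fin k → ℝ, ‖WithLp.toLp 2 (M *ᵥ u)‖ ≤ S * ‖WithLp.toLp 2 u‖) (δ : ℝ)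
    (x : Fin k → ℝ) :
    ‖WithLp.toLp 2 (Mᵀ *ᵥ residualVec M δ x)‖ ≤ S ^ 2 * ‖WithLp.toLp 2 (errorVec M δ x)‖ := by
  set w := Mᵀ *ᵥ residualVec M δ x with hw
  have h1 : ‖WithLp.toLp 2 w‖ ^ 2 = (M *ᵥ w) ⬝ᵥ (M *ᵥ errorVec M δ x) := by
    rw [norm_toLp_sq_eq_dotProduct]
    nth_rewrite 2 [hw]
    rw [← transpose_mulVec_mulVec_errorVec hinj, Matrix.dotProduct_mulVec _ Mᵀ,
      Matrix.vecMul_transpose]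
  have h2 := dotProduct_le_norm_mul_norm (M *ᵥ w) (M *ᵥ errorVec M δ x)
  have h3 := mul_le_mul (hS w) (hS (errorVec M δ x)) (norm_nonneg _) (by positivity)
  rcases (norm_nonneg (WithLp.toLp 2 w)).eq_or_lt with h0 | h0
  · rw [← h0]; positivity
  · refine le_of_mul_le_mul_left ?_ h0
    nlinarith

end Reconstruction

/-! ### Error bounds for a Gaussian frame -/

/-- The main term of the error bounds never exceeds a multiple of `δ`. -/
theorem mul_exp_neg_sq_div_sq_le {δ : ℝ} (hδ : 0 < δ) {r : ℝ} :
    r * Real.exp (-(2 * Real.pi ^ 2 * r ^ 2) / δ ^ 2) ≤ δ := by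
  have h1 := Real.add_one_le_exp ((2 * Real.pi ^ 2 * r ^ 2) / δ ^ 2)
  have h2 : r / δ ≤ (2 * Real.pi ^ 2 * r ^ 2) / δ ^ 2 + 1 := by
    have hpi : 1 ≤ 2 * Real.pi ^ 2 := by nlinarith [Real.pi_gt_three]
    have h3 : (r / δ) ^ 2 ≤ (2 * Real.pi ^ 2 * r ^ 2) / δ ^ 2 := by
      rw [div_pow]
      gcongr
      exact le_mul_of_one_le_left (sq_nonneg r) hpi
    nlinarith [sq_nonneg (r / δ - 1)]
  rw [neg_div, Real.exp_neg, ← div_eq_mul_inv, div_le_iff₀ (Real.exp_pos _), ← div_le_iff₀' hδ]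
  exact h2.trans h1

theorem norm_toLp_lt_of_forall_abs_lt {k : ℕ} (hk : 0 < k) {v : Fin k → ℝ} {τ : ℝ}
    (h : ∀ i, |v i| < τ) : ‖WithLp.toLp 2 v‖ < √k * τ := by
  have hτ : 0 < τ := (abs_nonneg _).trans_lt (h ⟨0, hk⟩)
  refine lt_of_pow_lt_pow_left₀ 2 (by positivity) ?_
  rw [EuclideanSpace.real_norm_sq_eq, mul_pow, Real.sq_sqrt (Nat.cast_nonneg k)]
  have : NeZero k := ⟨hk.ne'⟩
  refine (Finset.sum_lt_sum_of_nonempty (g := fun _ => τ ^ 2) Finset.univ_nonempty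
    fun i _ => ?_).trans_le (le_of_eq (by simp))
  exact sq_lt_sq' (abs_lt.1 (h i)).1 (abs_lt.1 (h i)).2

/-- The union bound over coordinates costs a factor `2 k`, which the factor `ln k` in the exponent
absorbs. -/
theorem two_mul_mul_exp_neg_le {k : ℕ} (hk : 3 ≤ k) {c κ : ℝ} (hc0 : 0 < c) (hc1 : c < 1)
    (hκ : Real.log (Real.exp 2 * c⁻¹) * Real.log k ≤ κ ^ 2) :
    k * (2 * Real.exp (-κ ^ 2)) ≤ c := by
  have hk0 : (0 : ℝ) < k := by positivity
  have hlogk : 1 ≤ Real.log k := by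
    rw [Real.le_log_iff_exp_le hk0]
    have : (3 : ℝ) ≤ k := by exact_mod_cast hk
    linarith [Real.exp_one_lt_d9]
  have hlogc : Real.log c < 0 := Real.log_neg hc0 hc1
  rw [Real.log_mul (Real.exp_pos _).ne' (inv_ne_zero hc0.ne'), Real.log_exp, Real.log_inv] at hκ
  have h2 : (2 : ℝ) ≤ Real.exp 1 := by linarith [Real.exp_one_gt_d9]
  calc k * (2 * Real.exp (-κ ^ 2)) ≤
        Real.exp (Real.log k) * (Real.exp 1 * Real.exp (-κ ^ 2)) := by
        rw [Real.exp_log hk0]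
        gcongr
    _ = Real.exp (Real.log k + (1 + -κ ^ 2)) := by rw [Real.exp_add, Real.exp_add]
    _ ≤ Real.exp (Real.log c) := Real.exp_le_exp.2 (by nlinarith)
    _ = c := Real.exp_log hc0

/-- No measurability is needed: only the subadditivity of the outer measure is used. -/
theorem ofReal_one_sub_le_of_compl {Ω : Type*} [MeasurableSpace Ω] (P : Measure Ω)
    [IsProbabilityMeasure P] {s t : Set Ω} {q : ℝ} (ht : P.real t ≤ q) (hst : tᶜ ⊆ s) :
    ENNReal.ofReal (1 - q) ≤ P s := by
  have h1 : (1 : ℝ) ≤ P.real t + P.real s := by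
    have h := measureReal_union_le (μ := P) t s
    have hu : t ∪ s = Set.univ := by
      refine Set.eq_univ_of_forall fun ω => ?_
      by_cases hω : ω ∈ t
      · exact Or.inl hω
      · exact Or.inr (hst hω)
    rwa [hu, probReal_univ] at h
  rw [← ofReal_measureReal (μ := P) (s := s)]
  exact ENNReal.ofReal_le_ofReal (by linarith)

namespace IsGaussianMatrix

variable {Ω : Type*} [MeasurableSpace Ω] {P : Measure Ω} [IsProbabilityMeasure P] {m k : ℕ}
  {E : Ω → Matrix (Fin m) (Fin k) ℝ}

/-- With probability at least `1 - c`, the vector `Eᵀ r / m` is close to its mean, which is a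
multiple of `x`. -/
theorem measure_norm_transpose_mulVec_sub_ge_le (hE : IsGaussianMatrix E P) (hk : 3 ≤ k)
    (hm : 0 < m) {δ : ℝ} (hδ : 0 < δ) (x : Fin k → ℝ) {c κ : ℝ} (hc0 : 0 < c) (hc1 : c < 1)
    (hκ0 : 0 ≤ κ) (hκ : Real.log (Real.exp 2 * c⁻¹) * Real.log k ≤ κ ^ 2) {D : ℝ}
    (hD : ∀ i, ∫ g, g i * quantResidual δ (g ⬝ᵥ x) ∂(stdGaussianPi (Fin k)) = D * x i) :
    P.real {ω | ¬ ‖WithLp.toLp 2 ((E ω)ᵀ *ᵥ residualVec (E ω) δ x - (m * D) • x)‖ <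
      √k * (κ * √m * δ)} ≤ c := by
  have hm' : (0 : ℝ) < m := by exact_mod_cast hm
  set τ := κ * √m * δ with hτ
  have hτ0 : 0 ≤ τ := by positivity
  have hsub : {ω | ¬ ‖WithLp.toLp 2 ((E ω)ᵀ *ᵥ residualVec (E ω) δ x - (m * D) • x)‖ < √k * τ} ⊆
      ⋃ i ∈ (Finset.univ : Finset (Fin k)),
        {ω | τ ≤ |∑ j, E ω j i * quantResidual δ (E ω j ⬝ᵥ x) -
          m * ∫ g, g i * quantResidual δ (g ⬝ᵥ x) ∂(stdGaussianPi (Fin k))|} := by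
    intro ω hω
    by_contra hnot
    simp only [Finset.mem_univ, Set.iUnion_true, Set.mem_iUnion, Set.mem_ofPred_eq, not_exists,
      not_le] at hnot
    refine hω (norm_toLp_lt_of_forall_abs_lt (by omega) fun i => ?_)
    have h := hnot i
    rw [hD, ← mul_assoc] at h
    exact h
  refine (measureReal_mono hsub (measure_ne_top P _)).trans
    ((measureReal_biUnion_finset_le _ _).trans ?_)
  refine (Finset.sum_le_sum fun i _ =>
    hE.measure_abs_sum_mul_quantResidual_sub_ge_le hδ x i hτ0).trans ?_
  have hexp : -τ ^ 2 / (m * δ ^ 2) = -κ ^ 2 := by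
    rw [hτ, mul_pow, mul_pow, Real.sq_sqrt hm'.le]
    field_simp
  rw [hexp, Finset.sum_const, Finset.card_univ, Fintype.card_fin, nsmul_eq_mul]
  exact two_mul_mul_exp_neg_le hk hc0 hc1 hκ

end IsGaussianMatrix

namespace IsGaussianMatrix

variable {Ω : Type*} [MeasurableSpace Ω] {P : Measure Ω} [IsProbabilityMeasure P] {m k : ℕ}
  {E : Ω → Matrix (Fin m) (Fin k) ℝ}

/-- If the error term `T` is large compared with `δ`, the upper bound follows from the trivial bound
on the residuals, and the lower bound is negative. -/
theorem error_bounds_of_le (hE : IsGaussianMatrix E P) (hm : 0 < m) (hk : 4 * k ≤ m) {δ : ℝ}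
    (hδ : 0 < δ) (x : EuclideanSpace ℝ (Fin k)) {T A A' : ℝ} (hT : 20 * δ ≤ T) (hA : 4 ≤ A)
    (hA' : 0 < A') :
    ENNReal.ofReal (1 - 2 * Real.exp (-(m : ℝ) / 8)) ≤
      P {ω | (E ω).rank = k ∧
        reconstructionError δ (E ω) x <
          A * (2 * ‖x‖ * Real.exp (-(2 * Real.pi ^ 2 * ‖x‖ ^ 2) / δ ^ 2) + T) ∧
        A' * (2 * ‖x‖ * Real.exp (-(2 * Real.pi ^ 2 * ‖x‖ ^ 2) / δ ^ 2)
            - 2 * ‖x‖ * Real.exp (-(8 * Real.pi ^ 2 * ‖x‖ ^ 2) / δ ^ 2) - T) <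
          reconstructionError δ (E ω) x} := by
  have hm0 : (0 : ℝ) < m := by exact_mod_cast hm
  refine ofReal_one_sub_le_of_compl P (hE.measure_not_bounds_le_of_four_mul_le hk) fun ω hω => ?_
  have hω' := not_not.1 hω
  have hs := fun u => (hω' u).1
  have hs0 : 0 < 1 / 20 * √(m : ℝ) := by positivity
  refine ⟨rank_eq_of_mulVec_injective (mulVec_injective_of_bound hs0 hs), ?_, ?_⟩
  · rw [reconstructionError_eq]
    have h2 := (mul_norm_errorVec_le hs0 hs δ x.ofLp).trans (norm_residualVec_le hδ x.ofLp)
    have h3 : ‖WithLp.toLp 2 (errorVec (E ω) δ x.ofLp)‖ ≤ 10 * δ := by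
      refine le_of_mul_le_mul_left ?_ hs0
      linarith
    have h4 : 0 ≤ 2 * ‖x‖ * Real.exp (-(2 * Real.pi ^ 2 * ‖x‖ ^ 2) / δ ^ 2) := by positivity
    have h5 := mul_le_mul_of_nonneg_right hA
      (a := 2 * ‖x‖ * Real.exp (-(2 * Real.pi ^ 2 * ‖x‖ ^ 2) / δ ^ 2) + T) (by linarith)
    linarith
  · have h1 : ‖x‖ * Real.exp (-(2 * Real.pi ^ 2 * ‖x‖ ^ 2) / δ ^ 2) ≤ δ :=
      mul_exp_neg_sq_div_sq_le hδ
    have h2 : 0 ≤ ‖x‖ * Real.exp (-(8 * Real.pi ^ 2 * ‖x‖ ^ 2) / δ ^ 2) := by positivity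
    refine lt_of_lt_of_le (mul_neg_of_pos_of_neg hA' ?_) (norm_nonneg _)
    linarith

/-- For large redundancy the matrix is nearly a multiple of an isometry, and `Eᵀ r / m`
concentrates around its mean. -/
theorem error_bounds_of_mul_le (hE : IsGaussianMatrix E P) (hk3 : 3 ≤ k) (hk : 200 * k ≤ m) {δ : ℝ}
    (hδ : 0 < δ) (x : EuclideanSpace ℝ (Fin k)) {c κ A A' : ℝ} (hc0 : 0 < c) (hc1 : c < 1)
    (hκ0 : 0 ≤ κ) (hκ : Real.log (Real.exp 2 * c⁻¹) * Real.log k ≤ κ ^ 2) (hA : 4 ≤ A)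
    (hA'0 : 0 < A') (hA' : A' ≤ 4 / 9) :
    ENNReal.ofReal (1 - (2 * Real.exp (-(m : ℝ) / 8) + c)) ≤
      P {ω | (E ω).rank = k ∧
        reconstructionError δ (E ω) x <
          A * (2 * ‖x‖ * Real.exp (-(2 * Real.pi ^ 2 * ‖x‖ ^ 2) / δ ^ 2) +
            κ * (√k / √m) * δ) ∧
        A' * (2 * ‖x‖ * Real.exp (-(2 * Real.pi ^ 2 * ‖x‖ ^ 2) / δ ^ 2)
            - 2 * ‖x‖ * Real.exp (-(8 * Real.pi ^ 2 * ‖x‖ ^ 2) / δ ^ 2) -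
            κ * (√k / √m) * δ) <
          reconstructionError δ (E ω) x} := by
  have hm : 0 < m := by omega
  have hm0 : (0 : ℝ) < m := by exact_mod_cast hm
  have hsqm : √(m : ℝ) * √m = m := Real.mul_self_sqrt hm0.le
  have hx0 := norm_nonneg x
  obtain ⟨D, hD1, hD2, hD⟩ := exists_integral_mul_quantResidual_eq hδ x.ofLp
  rw [← norm_toLp_sq_eq_dotProduct, WithLp.toLp_ofLp, ← neg_div, ← neg_div] at hD1
  rw [← norm_toLp_sq_eq_dotProduct, WithLp.toLp_ofLp, ← neg_div] at hD2
  have hD0 : 0 ≤ D := by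
    refine le_trans (mul_nonneg zero_le_two (sub_nonneg.2 (Real.exp_le_exp.2 ?_))) hD1
    gcongr
    norm_num
  set e₁ := Real.exp (-(2 * Real.pi ^ 2 * ‖x‖ ^ 2) / δ ^ 2) with he₁
  set e₂ := Real.exp (-(8 * Real.pi ^ 2 * ‖x‖ ^ 2) / δ ^ 2) with he₂
  have hDx1 : 2 * ‖x‖ * e₁ - 2 * ‖x‖ * e₂ ≤ D * ‖x‖ := by
    have := mul_le_mul_of_nonneg_right hD1 hx0
    linarith
  have hDx2 : D * ‖x‖ ≤ 2 * ‖x‖ * e₁ := by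
    have := mul_le_mul_of_nonneg_right hD2 hx0
    linarith
  set T := κ * (√k / √m) * δ with hT
  have hT0 : 0 ≤ T := by positivity
  have hbad := (measureReal_union_le (μ := P) _ _).trans
    (add_le_add (hE.measure_not_bounds_le_of_mul_le hk)
      (hE.measure_norm_transpose_mulVec_sub_ge_le hk3 hm hδ x.ofLp hc0 hc1 hκ0 hκ hD))
  refine ofReal_one_sub_le_of_compl P hbad fun ω hω => ?_
  rw [Set.compl_union] at hω
  have hω1 := not_not.1 hω.1
  have hω2 := not_not.1 hω.2
  have hs := fun u => (hω1 u).1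
  have hS := fun u => (hω1 u).2
  have hs0 : 0 < 1 / 2 * √(m : ℝ) := by positivity
  have hinj := mulVec_injective_of_bound hs0 hs
  have hdev : √(k : ℝ) * (κ * √m * δ) = m * T := by
    rw [hT]
    field_simp
    rw [sq, hsqm]
  rw [hdev] at hω2
  set w := (E ω)ᵀ *ᵥ residualVec (E ω) δ x.ofLp with hw
  have hmean : ‖WithLp.toLp 2 ((m * D) • x.ofLp)‖ = m * (D * ‖x‖) := by
    rw [WithLp.toLp_smul, norm_smul, WithLp.toLp_ofLp, Real.norm_of_nonneg (by positivity)]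
    ring
  have hup : ‖WithLp.toLp 2 w‖ < m * (D * ‖x‖ + T) := by
    have h2 := norm_add_le (WithLp.toLp 2 (w - (m * D) • x.ofLp))
      (WithLp.toLp 2 ((m * D) • x.ofLp))
    rw [← WithLp.toLp_add, sub_add_cancel, hmean] at h2
    linarith
  have hlo : m * (D * ‖x‖ - T) < ‖WithLp.toLp 2 w‖ := by
    have h2 := norm_sub_le (WithLp.toLp 2 w) (WithLp.toLp 2 (w - (m * D) • x.ofLp))
    rw [← WithLp.toLp_sub, sub_sub_cancel, hmean] at h2
    linarith
  have h1 := (sq_mul_norm_errorVec_le hs0 hs δ x.ofLp).trans_lt hup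
  have h2 := hlo.trans_le
    (norm_transpose_mulVec_residualVec_le hinj (by positivity) hS δ x.ofLp)
  rw [mul_pow, Real.sq_sqrt hm0.le] at h1 h2
  rw [Set.mem_ofPred_eq, reconstructionError_eq]
  have hr0 := norm_nonneg (WithLp.toLp 2 (errorVec (E ω) δ x.ofLp))
  set r := ‖WithLp.toLp 2 (errorVec (E ω) δ x.ofLp)‖
  refine ⟨rank_eq_of_mulVec_injective hinj, ?_, ?_⟩
  · have h3 : r < 4 * (D * ‖x‖ + T) := by
      refine lt_of_mul_lt_mul_left ?_ hm0.le
      linarith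
    refine h3.trans_le (mul_le_mul hA ?_ (by positivity) (by linarith))
    linarith
  · have h3 : 4 / 9 * (D * ‖x‖ - T) < r := by
      refine lt_of_mul_lt_mul_left ?_ hm0.le
      linarith
    rcases lt_or_ge (2 * ‖x‖ * e₁ - 2 * ‖x‖ * e₂ - T) 0 with hb | hb
    · exact (mul_neg_of_pos_of_neg hA'0 hb).trans_le hr0
    · refine lt_of_le_of_lt (mul_le_mul hA' ?_ hb (by norm_num)) h3
      linarith

end IsGaussianMatrix

/-- The value `1000` of the absolute constant is chosen for convenience: it makes the error term
dominate every other quantity when the redundancy is below `200`. -/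
theorem reconstructionError_bounds {k : ℕ} (hk : 3 ≤ k) (x : EuclideanSpace ℝ (Fin k)) {δ : ℝ}
    (hδ : 0 < δ) {c₂ : ℝ} (hc0 : 0 < c₂) (hc1 : c₂ < 1) {c₁ : ℝ}
    (hc : c₁ = 1000 * √(Real.log (Real.exp 2 * c₂⁻¹))) {m : ℕ} {lam : ℝ}
    (hlam : lam = (m : ℝ) / (k : ℝ)) (h4 : 4 < lam) {A A' : ℝ}
    (hA : A = (1 / 2 - lam ^ (-(1 / 2) : ℝ)) ^ (-2 : ℤ))
    (hA' : A' = (3 / 2 + lam ^ (-(1 / 2) : ℝ)) ^ (-2 : ℤ))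
    {Ω : Type*} [MeasurableSpace Ω] (P : Measure Ω) [IsProbabilityMeasure P]
    (E : Ω → Matrix (Fin m) (Fin k) ℝ) (hE : IsGaussianMatrix E P) :
    ENNReal.ofReal (1 - 2 * Real.exp (-(m : ℝ) / 8) - c₂) ≤
      P {ω | (E ω).rank = k ∧
        reconstructionError δ (E ω) x <
          A * (2 * ‖x‖ * Real.exp (-(2 * Real.pi ^ 2 * ‖x‖ ^ 2) / δ ^ 2)
            + c₁ * √(Real.log k) * lam ^ (-(1 / 2) : ℝ) * δ) ∧
        A' * (2 * ‖x‖ * Real.exp (-(2 * Real.pi ^ 2 * ‖x‖ ^ 2) / δ ^ 2)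
            - 2 * ‖x‖ * Real.exp (-(8 * Real.pi ^ 2 * ‖x‖ ^ 2) / δ ^ 2)
            - c₁ * √(Real.log k) * lam ^ (-(1 / 2) : ℝ) * δ) <
          reconstructionError δ (E ω) x} := by
  have hk0 : (0 : ℝ) < k := by positivity
  have hlam0 : 0 < lam := by linarith
  have hm0 : (0 : ℝ) < m := by
    rw [hlam, lt_div_iff₀ hk0] at h4
    linarith
  have hm : 0 < m := by exact_mod_cast hm0
  have hpow : lam ^ (-(1 / 2) : ℝ) = (√lam)⁻¹ := by
    rw [Real.rpow_neg hlam0.le, ← Real.sqrt_eq_rpow]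
  rw [hpow] at hA hA' ⊢
  have hsl : 2 < √lam := by
    rw [Real.lt_sqrt (by norm_num)]
    linarith
  have hν0 : 0 < (√lam)⁻¹ := by positivity
  have hν2 : (√lam)⁻¹ < 1 / 2 := by
    rw [inv_lt_comm₀ (by positivity) (by norm_num)]
    linarith
  have hA4 : 4 ≤ A := by
    rw [hA, zpow_neg, le_inv_comm₀ (by norm_num) (zpow_pos (by linarith) _), zpow_ofNat]
    exact (pow_le_pow_left₀ (by linarith) (by linarith) 2).trans
      (by norm_num : (1 / 2 : ℝ) ^ 2 ≤ 4⁻¹)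
  have hA'0 : 0 < A' := by rw [hA']; positivity
  have hA'4 : A' ≤ 4 / 9 := by
    rw [hA', zpow_neg, inv_le_comm₀ (by positivity) (by norm_num), zpow_ofNat]
    exact (by norm_num : (4 / 9 : ℝ)⁻¹ ≤ (3 / 2) ^ 2).trans
      (pow_le_pow_left₀ (by norm_num) (by linarith) 2)
  have hlogk : 1 ≤ Real.log k := by
    rw [Real.le_log_iff_exp_le hk0]
    have : (3 : ℝ) ≤ k := by exact_mod_cast hk
    linarith [Real.exp_one_lt_d9]
  have hlogc : 2 ≤ Real.log (Real.exp 2 * c₂⁻¹) := by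
    rw [Real.log_mul (Real.exp_pos _).ne' (inv_ne_zero hc0.ne'), Real.log_exp, Real.log_inv]
    linarith [Real.log_neg hc0 hc1]
  have hκ1000 : 1000 ≤ c₁ * √(Real.log k) := by
    have h1 : (1 : ℝ) ≤ √(Real.log (Real.exp 2 * c₂⁻¹)) := by
      rw [Real.one_le_sqrt]
      linarith
    have h2 : (1 : ℝ) ≤ √(Real.log k) := by rwa [Real.one_le_sqrt]
    have h3 := one_le_mul_of_one_le_of_one_le h1 h2
    rw [hc, mul_assoc]
    linarith
  have hκsq : Real.log (Real.exp 2 * c₂⁻¹) * Real.log k ≤ (c₁ * √(Real.log k)) ^ 2 := by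
    rw [hc, mul_pow, mul_pow, Real.sq_sqrt (by linarith), Real.sq_sqrt (by linarith), mul_assoc]
    refine le_mul_of_one_le_left ?_ (by norm_num)
    apply mul_nonneg <;> linarith
  rcases lt_or_ge lam 200 with h200 | h200
  · have hk4 : 4 * k ≤ m := by
      have : (4 : ℝ) * k ≤ m := by
        rw [hlam, lt_div_iff₀ hk0] at h4
        exact h4.le
      exact_mod_cast this
    have hν15 : (15 : ℝ)⁻¹ ≤ (√lam)⁻¹ := by
      refine inv_anti₀ (by positivity) ?_
      rw [Real.sqrt_le_left (by norm_num)]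
      linarith
    have hT : 20 * δ ≤ c₁ * √(Real.log k) * (√lam)⁻¹ * δ := by
      refine mul_le_mul_of_nonneg_right ?_ hδ.le
      exact le_trans (by norm_num) (mul_le_mul hκ1000 hν15 (by norm_num) (by linarith))
    exact (ENNReal.ofReal_le_ofReal (sub_le_self _ hc0.le)).trans
      (hE.error_bounds_of_le hm hk4 hδ x hT hA4 hA'0)
  · have hk200 : 200 * k ≤ m := by
      have : (200 : ℝ) * k ≤ m := by
        rwa [hlam, le_div_iff₀ hk0] at h200
      exact_mod_cast this
    have h := hE.error_bounds_of_mul_le hk hk200 hδ x hc0 hc1 (by linarith) hκsq hA4 hA'0 hA'4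
    rw [← inv_div √(m : ℝ), ← Real.sqrt_div hm0.le, ← hlam] at h
    rwa [sub_sub]

/-- The error stays away from zero as the redundancy grows: the error term of the lower bound tends
to zero, while its main term `B` is positive and `A' ≥ 1 / 4`. -/
theorem exists_lt_reconstructionError {k : ℕ} (hk : 3 ≤ k) {x : EuclideanSpace ℝ (Fin k)}
    (hx : x ≠ 0) {δ : ℝ} (hδ : 0 < δ) :
    ∃ ε : ℝ, 0 < ε ∧ ∀ (η : ℝ), 0 < η → ∃ M : ℕ, ∀ (m : ℕ), M ≤ m →
      ∀ (Ω : Type*) [MeasurableSpace Ω] (P : Measure Ω) [IsProbabilityMeasure P]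
        (E : Ω → Matrix (Fin m) (Fin k) ℝ), IsGaussianMatrix E P →
        ENNReal.ofReal (1 - η) ≤
          P {ω | (E ω).rank = k ∧ ε < reconstructionError δ (E ω) x} := by
  have hx0 : 0 < ‖x‖ := norm_pos_iff.2 hx
  have hk0 : (0 : ℝ) < k := by positivity
  set B := 2 * ‖x‖ * Real.exp (-(2 * Real.pi ^ 2 * ‖x‖ ^ 2) / δ ^ 2) -
    2 * ‖x‖ * Real.exp (-(8 * Real.pi ^ 2 * ‖x‖ ^ 2) / δ ^ 2) with hB
  have hB0 : 0 < B := by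
    rw [hB, sub_pos]
    gcongr
    norm_num
  refine ⟨B / 8, by positivity, fun η hη => ?_⟩
  set c₂ : ℝ := min (η / 2) (1 / 2) with hc₂
  have hc0 : 0 < c₂ := by positivity
  have hc1 : c₂ < 1 := (min_le_right _ _).trans_lt (by norm_num)
  set c₁ : ℝ := 1000 * √(Real.log (Real.exp 2 * c₂⁻¹)) with hc₁
  have hdiv : Filter.Tendsto (fun m : ℕ => (m : ℝ) / k) Filter.atTop Filter.atTop :=
    tendsto_natCast_atTop_atTop.atTop_div_const hk0
  have hlim1 : Filter.Tendsto (fun m : ℕ => 2 * Real.exp (-(m : ℝ) / 8)) Filter.atTop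
      (nhds (2 * 0)) := by
    refine (Real.tendsto_exp_atBot.comp ?_).const_mul 2
    simp_rw [neg_div]
    exact Filter.tendsto_neg_atTop_atBot.comp
      (tendsto_natCast_atTop_atTop.atTop_div_const (by norm_num))
  have hlim2 : Filter.Tendsto
      (fun m : ℕ => c₁ * √(Real.log k) * ((m : ℝ) / k) ^ (-(1 / 2) : ℝ) * δ) Filter.atTop
      (nhds (c₁ * √(Real.log k) * 0 * δ)) :=
    (((tendsto_rpow_neg_atTop (by norm_num)).comp hdiv).const_mul _).mul_const _
  have hev := ((hlim1.eventually_lt_const (u := η / 2) (by linarith)).and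
    ((hlim2.eventually_lt_const (u := B / 2) (by linarith)).and (hdiv.eventually_gt_atTop 4)))
  obtain ⟨M, hM⟩ := Filter.eventually_atTop.1 hev
  refine ⟨M, fun m hm Ω _ P _ E hE => ?_⟩
  obtain ⟨h1, h2, h4⟩ := hM m hm
  have hmain := reconstructionError_bounds hk x hδ hc0 hc1 hc₁ rfl h4 rfl rfl P E hE
  refine (ENNReal.ofReal_le_ofReal ?_).trans (hmain.trans (measure_mono fun ω hω => ?_))
  · linarith [min_le_left (η / 2) (1 / 2)]
  · refine ⟨hω.1, lt_of_le_of_lt ?_ hω.2.2⟩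
    have hν0 : 0 < ((m : ℝ) / k) ^ (-(1 / 2) : ℝ) := Real.rpow_pos_of_pos (by linarith) _
    have hν1 : ((m : ℝ) / k) ^ (-(1 / 2) : ℝ) ≤ 1 / 2 := by
      rw [Real.rpow_neg (by positivity), ← Real.sqrt_eq_rpow, one_div]
      refine inv_anti₀ (by norm_num) ?_
      rw [Real.le_sqrt' (by norm_num)]
      linarith
    set ν := ((m : ℝ) / k) ^ (-(1 / 2) : ℝ)
    have hA' : 1 / 4 ≤ (3 / 2 + ν) ^ (-2 : ℤ) := by
      rw [zpow_neg, le_inv_comm₀ (by norm_num) (by positivity), zpow_ofNat]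
      nlinarith
    calc B / 8 = 1 / 4 * (B / 2) := by ring
      _ ≤ (3 / 2 + ν) ^ (-2 : ℤ) * (B - c₁ * √(Real.log k) * ν * δ) := by
        gcongr
        linarith

theorem mainTheorem3 :
    (∃ C : ℝ, 0 < C ∧
      ∀ (k : ℕ), 3 ≤ k → ∀ (x : EuclideanSpace ℝ (Fin k)) (δ : ℝ), 0 < δ →
      ∀ (c₂ : ℝ), 0 < c₂ → c₂ < 1 →
      ∀ (c₁ : ℝ), c₁ = C * √(Real.log (Real.exp 2 * c₂⁻¹)) →
      ∀ (m : ℕ) (lam : ℝ), lam = (m : ℝ) / (k : ℝ) → 4 < lam →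
      ∀ (A A' : ℝ), A = (1 / 2 - lam ^ (-(1 / 2) : ℝ)) ^ (-2 : ℤ) →
        A' = (3 / 2 + lam ^ (-(1 / 2) : ℝ)) ^ (-2 : ℤ) →
      ∀ (Ω : Type*) [MeasurableSpace Ω] (P : Measure Ω) [IsProbabilityMeasure P]
        (E : Ω → Matrix (Fin m) (Fin k) ℝ), IsGaussianMatrix E P →
        ENNReal.ofReal (1 - 2 * Real.exp (-(m : ℝ) / 8) - c₂) ≤
          P {ω | (E ω).rank = k ∧
            reconstructionError δ (E ω) x <
              A * (2 * ‖x‖ * Real.exp (-(2 * Real.pi ^ 2 * ‖x‖ ^ 2) / δ ^ 2)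
                + c₁ * √(Real.log k) * lam ^ (-(1 / 2) : ℝ) * δ) ∧
            A' * (2 * ‖x‖ * Real.exp (-(2 * Real.pi ^ 2 * ‖x‖ ^ 2) / δ ^ 2)
                - 2 * ‖x‖ * Real.exp (-(8 * Real.pi ^ 2 * ‖x‖ ^ 2) / δ ^ 2)
                - c₁ * √(Real.log k) * lam ^ (-(1 / 2) : ℝ) * δ) <
              reconstructionError δ (E ω) x}) ∧
    (∀ (k : ℕ), 3 ≤ k → ∀ (x : EuclideanSpace ℝ (Fin k)), x ≠ 0 → ∀ (δ : ℝ), 0 < δ →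
      ∃ ε : ℝ, 0 < ε ∧ ∀ (η : ℝ), 0 < η → ∃ M : ℕ, ∀ (m : ℕ), M ≤ m →
        ∀ (Ω : Type*) [MeasurableSpace Ω] (P : Measure Ω) [IsProbabilityMeasure P]
          (E : Ω → Matrix (Fin m) (Fin k) ℝ), IsGaussianMatrix E P →
          ENNReal.ofReal (1 - η) ≤
            P {ω | (E ω).rank = k ∧ ε < reconstructionError δ (E ω) x}) := by
  refine ⟨⟨1000, by norm_num, ?_⟩, fun k hk x hx δ hδ => exists_lt_reconstructionError hk hx hδ⟩
  intro k hk x δ hδ c₂ hc0 hc1 c₁ hc m lam hlam h4 A A' hA hA' Ω _ P _ E hE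
  exact reconstructionError_bounds hk x hδ hc0 hc1 hc hlam h4 hA hA' P E hE
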